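/- Let $\ell>0$ and let $q\in W^{-1,2}(0,\ell)$ (the dual of $W^{1,2}_0(0,\ell)$, complex-valued). For $y\in W^{1,2}(0,\ell)$ let $\mathbf S_q y\in W^{-1,2}(0,\ell)$ be the distribution $$(\mathbf S_qy\,|\,\phi)=\int_0^\ell y'\phi'\,dx+(q\,|\,y\phi),\qquad \phi\in W^{1,2}_0(0,\ell),$$ and let $\mathscr D_2(\mathbf S_q)$ be the set of all $y\in W^{1,2}(0,\ell)$ for which $\mathbf S_qy$ is an $L^2$-regular distribution (is given by a function in $L^2(0,\ell)$, again denoted $\mathbf S_q y$). Assume that there is $f\in\mathscr D_2(\mathbf S_q)$ with $\mathbf S_qf=0$, $f(x)\ne0$ for all $x\in[0,\ell]$ and $f(0)=1$; write $\mathbf S_f=\mathbf S_q$. For $g\in\{f,\tfrac1f\}$ put $\mathbf D_{g}y=g\,(y/g)'$ for $y\in W^{1,2}(0,\ell)$, and let $\mathbf S_{1/f}=\mathbf S_{q_{1/f}}$, where $$q_{1/f}=f\Bigl(\frac1f\Bigr)'',\qquad (q_{1/f}\,|\,\phi)=\int_0^\ell\Bigl\{\Bigl(\frac{f'}{f}\Bigr)^2\phi+\frac{f'}{f}\,\phi'\Bigr\}dx,$$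 is the Darboux transform of $q$. For $\rho\in\mathbb C$ let $e_g(\rho,\cdot)\in\mathscr D_2(\mathbf S_g)$ be the solution of $\mathbf S_g e=\rho^2e$ on $(0,\ell)$ with $e(0)=1$ and $\mathbf D_ge(0)=i\rho$. For $g\in\{f,\tfrac1f\}$ there is a kernel $K_g$, square integrable on $\{(x,t):0\le x\le\ell,\ |t|\le x\}$ and with $K_g(x,\cdot)\in L^2(-x,x)$ for every $x\in(0,\ell)$, such that $$e_g(\rho,x)=e^{i\rho x}+\int_{-x}^{x}K_g(x,t)e^{i\rho t}\,dt\qquad(0<x<\ell,\ \rho\in\mathbb C).$$ For any such kernels $K_f$ and $K_{1/f}$, let $\mathbf T_gy(x)=y(x)+\int_{-x}^xK_g(x,t)y(t)\,dt$ for $y\in L^2(-\ell,\ell)$. Then: 1. $\mathbf T_f\bigl(W^{1,2}(-\ell,\ell)\bigr)\subset W^{1,2}(0,\ell)$, and $\mathbf D_f\mathbf T_fy=\mathbf T_{1/f}\,y'$ a.e. on $(0,\ell)$ for every $y\in W^{1,2}(-\ell,\ell)$. 2. $\mathbf T_f\bigl(W^{2,2}(-\ell,\ell)\bigr)\subset\mathscr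 D_2(\mathbf S_f)$, and $\mathbf S_f\mathbf T_fy=-\mathbf T_f\,y''$ in $L^2(0,\ell)$ for every $y\in W^{2,2}(-\ell,\ell)$. -/

import Mathlib

open MeasureTheory Set
open scoped ContDiff

noncomputable section

namespace DistSchrodinger

/-! Elements of `L²(a,b)` and of the Sobolev spaces are represented by functions `ℝ → ℂ`; only their
restriction to the interval, up to null sets, matters. -/

/-- The space `C₀^∞(a,b)` of complex-valued test functions. -/
def IsTestFunction (a b : ℝ) (φ : ℝ → ℂ) : Prop :=
  ContDiff ℝ ∞ φ ∧ HasCompactSupport φ ∧ tsupport φ ⊆ Ioo a b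

/-- `g` is the distributional derivative of `u` on `(a,b)`, both being regular distributions. -/
def HasWeakDeriv (a b : ℝ) (u g : ℝ → ℂ) : Prop :=
  LocallyIntegrableOn u (Ioo a b) ∧ LocallyIntegrableOn g (Ioo a b) ∧
    ∀ φ, IsTestFunction a b φ →
      ∫ x in Ioo a b, u x * deriv φ x = -∫ x in Ioo a b, g x * φ x

open Classical in
/-- The weak derivative of `u` on `(a,b)`, determined up to a null set
(and `0` if `u` has no weak derivative). -/
def weakDeriv (a b : ℝ) (u : ℝ → ℂ) : ℝ → ℂ :=
  if h : ∃ g, HasWeakDeriv a b u g then h.choose else 0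

/-- `u ∈ L²(a,b)`. -/
def MemL2 (a b : ℝ) (u : ℝ → ℂ) : Prop :=
  MemLp u 2 (volume.restrict (Ioo a b))

/-- `u ∈ W^{1,2}(a,b)`. -/
def MemW12 (a b : ℝ) (u : ℝ → ℂ) : Prop :=
  MemL2 a b u ∧ ∃ g, MemL2 a b g ∧ HasWeakDeriv a b u g

/-- `u ∈ W^{2,2}(a,b)`. -/
def MemW22 (a b : ℝ) (u : ℝ → ℂ) : Prop :=
  MemW12 a b u ∧ MemW12 a b (weakDeriv a b u)

/-- `u ∈ W₀^{1,2}(a,b)`: the continuous representative on `[a,b]` vanishes at both endpoints. -/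
def MemW12Zero (a b : ℝ) (u : ℝ → ℂ) : Prop :=
  MemW12 a b u ∧ ∃ v : ℝ → ℂ, ContinuousOn v (Icc a b) ∧
    u =ᵐ[volume.restrict (Ioo a b)] v ∧ v a = 0 ∧ v b = 0

/-- The norm of `W^{1,2}(a,b)`. -/
def normW12 (a b : ℝ) (u : ℝ → ℂ) : ℝ :=
  Real.sqrt ((∫ x in Ioo a b, ‖u x‖ ^ 2) + ∫ x in Ioo a b, ‖weakDeriv a b u x‖ ^ 2)

/-- `q ∈ W^{-1,2}(a,b)`: a bounded linear functional on `W₀^{1,2}(a,b)`.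
The values of `q` off `W₀^{1,2}(a,b)` are irrelevant. -/
structure IsNegSobolev (a b : ℝ) (q : (ℝ → ℂ) → ℂ) : Prop where
  map_add : ∀ φ ψ, MemW12Zero a b φ → MemW12Zero a b ψ → q (φ + ψ) = q φ + q ψ
  map_smul : ∀ (c : ℂ) (φ), MemW12Zero a b φ → q (c • φ) = c * q φ
  bounded : ∃ C : ℝ, ∀ φ, MemW12Zero a b φ → ‖q φ‖ ≤ C * normW12 a b φ

/-- The pairing `(S_q y | φ) = ∫ y' φ' + (q | y φ)`, where `S_q y = -y'' + q y`
as an element of `W^{-1,2}(a,b)`. -/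
def schrodingerPairing (a b : ℝ) (q : (ℝ → ℂ) → ℂ) (y φ : ℝ → ℂ) : ℂ :=
  (∫ x in Ioo a b, weakDeriv a b y x * weakDeriv a b φ x) + q (fun x => y x * φ x)

/-- `S_q y` is the `L²`-regular distribution given by `g ∈ L²(a,b)`, that is, `S_q y = g`. -/
def SchrodingerEq (a b : ℝ) (q : (ℝ → ℂ) → ℂ) (y g : ℝ → ℂ) : Prop :=
  MemL2 a b g ∧ ∀ φ, MemW12Zero a b φ →
    schrodingerPairing a b q y φ = ∫ x in Ioo a b, g x * φ x

/-- The domain of `L²`-regularization of `S_q`: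
those `y ∈ W^{1,2}(a,b)` for which `S_q y` is an `L²`-regular distribution. -/
def regularizationDomain (a b : ℝ) (q : (ℝ → ℂ) → ℂ) : Set (ℝ → ℂ) :=
  {y | MemW12 a b y ∧ ∃ g, SchrodingerEq a b q y g}

/-- `f` (taken as its continuous representative on `[a,b]`) is a nonvanishing solution
of `S_q f = 0`. -/
structure IsNonvanishingSolution (a b : ℝ) (q : (ℝ → ℂ) → ℂ) (f : ℝ → ℂ) : Prop where
  continuousOn : ContinuousOn f (Icc a b)
  mem_domain : f ∈ regularizationDomain a b q
  eq_zero : SchrodingerEq a b q f 0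
  ne_zero : ∀ x ∈ Icc a b, f x ≠ 0

/-- `D_f y = f (y / f)'`; hence `D_{1/f}` is `opD a b f⁻¹`. -/
def opD (a b : ℝ) (f y : ℝ → ℂ) : ℝ → ℂ :=
  fun x => f x * weakDeriv a b (fun s => y s / f s) x

/-- The distribution `q_f = f'' / f`,
`(q_f | φ) = ∫ ((f'/f)² φ - (f'/f) φ')`. -/
def potentialOf (a b : ℝ) (f : ℝ → ℂ) (φ : ℝ → ℂ) : ℂ :=
  ∫ x in Ioo a b, ((weakDeriv a b f x / f x) ^ 2 * φ x
    - weakDeriv a b f x / f x * weakDeriv a b φ x)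

/-- The Darboux transformation `q_{1/f} = f (1/f)''` of the potential `q = q_f`. -/
def darbouxPotential (a b : ℝ) (f : ℝ → ℂ) : (ℝ → ℂ) → ℂ :=
  potentialOf a b f⁻¹

/-- `e` is (the continuous representative of) the solution `e_f(ρ, ·)` on `(0,ℓ)` of
`S_q e = ρ² e`, `e(0) = 1`, `D_f e(0) = iρ`. The last value is that of the continuous representative
of `D_f e`. -/
structure IsExpSolution (ℓ : ℝ) (q : (ℝ → ℂ) → ℂ) (f : ℝ → ℂ) (ρ : ℂ) (e : ℝ → ℂ) : Prop where
  continuousOn : ContinuousOn e (Icc 0 ℓ)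
  mem_domain : e ∈ regularizationDomain 0 ℓ q
  eq : SchrodingerEq 0 ℓ q e (fun x => ρ ^ 2 * e x)
  init : e 0 = 1
  init_deriv : ∃ v : ℝ → ℂ, ContinuousOn v (Icc 0 ℓ) ∧
    opD 0 ℓ f e =ᵐ[volume.restrict (Ioo 0 ℓ)] v ∧ v 0 = Complex.I * ρ

/-- The triangle `0 ≤ x ≤ ℓ`, `|t| ≤ x`. -/
def triangle (ℓ : ℝ) : Set (ℝ × ℝ) :=
  {p | 0 ≤ p.1 ∧ p.1 ≤ ℓ ∧ |p.2| ≤ p.1}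

/-- The operator `T y(x) = y(x) + ∫_{-x}^{x} K(x,t) y(t) dt` with kernel `K`. -/
def transOp (K : ℝ → ℝ → ℂ) (y : ℝ → ℂ) : ℝ → ℂ :=
  fun x => y x + ∫ t in (-x)..x, K x t * y t

/-- `K` is the transmutation kernel `K_f`: it is square integrable on the triangle and on each of
its sections, and `e_f(ρ,x) = e^{iρx} + ∫_{-x}^{x} K(x,t) e^{iρt} dt` for all `ρ ∈ ℂ`, `0 < x < ℓ`.
This determines `K(x, ·)` almost everywhere on `(-x,x)` for each `x`. -/
structure IsTransmutationKernel (ℓ : ℝ) (q : (ℝ → ℂ) → ℂ) (f : ℝ → ℂ) (K : ℝ → ℝ → ℂ) : Prop where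
  memLp : MemLp (Function.uncurry K) 2 (volume.restrict (triangle ℓ))
  memLp_section : ∀ x ∈ Ioo 0 ℓ, MemL2 (-x) x (K x)
  representation : ∀ ρ : ℂ, ∃ e, IsExpSolution ℓ q f ρ e ∧
    ∀ x ∈ Ioo 0 ℓ, e x = transOp K (fun t : ℝ => Complex.exp (Complex.I * ρ * (t : ℂ))) x

end DistSchrodinger

end

open scoped Topology

/-! Write p = f'/f, an L² function. Testing S_q f = 0 against φ/f shows that q is the Miura
potential p² + p', and the Darboux transform is the Miura potential of -p. Hence S_q factors weakly
as -D_{1/f} D_f, with D_f y = y' - p y, and S_q y = g says exactly that f D_f y has a continuous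
representative with derivative -f g.

For an exponential solution e of parameter ρ, the pair A = e/f, B = f D_f e solves A' = f⁻² B, B' =
-ρ² f² A. Replacing f by 1/f exchanges the roles of A and B up to the factor iρ, so uniqueness for
this system (Gronwall) gives D_f e_f = iρ e_{1/f}. In terms of the transmutation operators this is
the first claim for y = e^{iρt}, and the case ρ = 0 reads T_f 1 = f.

The passage to general y is by density. Written in integral form, T_f(∫₀ᵗ h)(x) = f(x) ∫₀ˣ f⁻¹
T_{1/f} h, both sides are, for each fixed x, bounded linear functionals of h in L²(-ℓ,ℓ). They agree
on the functions e^{(n+1)t}, whose span is dense by Weierstrass in the variable e^t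
(`IsL2Functional.eq_zero_of_exp`, `IsTransmutationKernel.transOp_integral`). This gives the first
claim for all y in W^{1,2}. The second follows by using the first twice, for f and then for 1/f:
D_{1/f} D_f T_f y = D_{1/f} T_{1/f} y' = T_f y''.

Existence of the kernels is proved separately. The Dirac system y' = p y + iρ z, z' = -p z + iρ y
becomes, for a = e^{-iρx}(y + z) and b = e^{iρx}(y - z), the system a' = p e^{-2iρx} b, b' = p
e^{2iρx} a. A Fourier ansatz for a and b turns it into a Volterra system for kernels independent of
ρ, solved by a Neumann series in an exponentially weighted sup norm (`exists_volterra_solution`,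
`exists_dirac_kernels`). -/

namespace DistSchrodinger

/-! ### Calculus of absolutely continuous functions. -/

/-- `u` is a primitive of the integrable function `g` on `[a,b]`. -/
structure IsPrimitive (a b : ℝ) (u g : ℝ → ℂ) : Prop where
  intervalIntegrable : IntervalIntegrable g volume a b
  eq_add_integral : ∀ x ∈ Icc a b, u x = u a + ∫ t in a..x, g t

theorem absolutelyContinuousOnInterval_of_dist_le {X Y : Type*} [PseudoMetricSpace X]
    [PseudoMetricSpace Y] {F : ℝ → X} {G : ℝ → Y} {a b C : ℝ}
    (hF : AbsolutelyContinuousOnInterval F a b)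
    (h : ∀ x ∈ uIcc a b, ∀ y ∈ uIcc a b, dist (G x) (G y) ≤ C * dist (F x) (F y)) :
    AbsolutelyContinuousOnInterval G a b := by
  rw [absolutelyContinuousOnInterval_iff] at hF ⊢
  intro ε hε
  -- `C` may be zero or negative; `|C| + 1` is a positive constant that still dominates it.
  obtain ⟨δ, hδ, H⟩ := hF (ε / (|C| + 1)) (by positivity)
  refine ⟨δ, hδ, fun E hE hE' => ?_⟩
  have h1 := H E hE hE'
  calc ∑ i ∈ Finset.range E.1, dist (G (E.2 i).1) (G (E.2 i).2)
      ≤ ∑ i ∈ Finset.range E.1, (|C| + 1) * dist (F (E.2 i).1) (F (E.2 i).2) := by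
        refine Finset.sum_le_sum fun i hi => (h _ (hE.1 i hi).1 _ (hE.1 i hi).2).trans ?_
        gcongr
        linarith [le_abs_self C]
    _ = (|C| + 1) * ∑ i ∈ Finset.range E.1, dist (F (E.2 i).1) (F (E.2 i).2) := by
        rw [Finset.mul_sum]
    _ < (|C| + 1) * (ε / (|C| + 1)) := by gcongr
    _ = ε := by field_simp

namespace IsPrimitive

variable {a b : ℝ} {u v g h : ℝ → ℂ}

theorem sub_eq_integral (hu : IsPrimitive a b u g) {x y : ℝ} (hx : x ∈ Icc a b)
    (hy : y ∈ Icc a b) : u y - u x = ∫ t in x..y, g t := by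
  have hab : a ≤ b := hx.1.trans hx.2
  have i1 : ∀ z ∈ Icc a b, IntervalIntegrable g volume a z := fun z hz =>
    hu.intervalIntegrable.mono_set (by rw [uIcc_of_le hz.1, uIcc_of_le hab]; gcongr; exact hz.2)
  rw [hu.eq_add_integral x hx, hu.eq_add_integral y hy,
    ← intervalIntegral.integral_interval_sub_left (i1 y hy) (i1 x hx)]
  ring

/-- Increments of `u` are dominated by those of the primitive of `‖g‖`, whose absolute continuity is
the known case. -/
theorem absolutelyContinuous (hab : a ≤ b) (hu : IsPrimitive a b u g) :
    AbsolutelyContinuousOnInterval u a b := by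
  have hn := hu.intervalIntegrable.norm
  refine absolutelyContinuousOnInterval_of_dist_le (C := 1)
    (hn.absolutelyContinuousOnInterval_intervalIntegral (c := a) (by simp)) ?_
  intro x hx y hy
  have hx' := hx
  have hy' := hy
  rw [uIcc_of_le hab] at hx' hy'
  have i1 : ∀ z ∈ Icc a b, IntervalIntegrable (fun t => ‖g t‖) volume a z := fun z hz =>
    hn.mono_set (by rw [uIcc_of_le hz.1, uIcc_of_le hab]; gcongr; exact hz.2)
  rw [one_mul, dist_comm, dist_comm (∫ t in a..x, ‖g t‖), dist_eq_norm,
    hu.sub_eq_integral hx' hy', Real.dist_eq,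
    intervalIntegral.integral_interval_sub_left (i1 y hy') (i1 x hx')]
  exact intervalIntegral.norm_integral_le_abs_integral_norm

theorem continuousOn (hab : a ≤ b) (hu : IsPrimitive a b u g) : ContinuousOn u (Icc a b) := by
  simpa [uIcc_of_le hab] using (hu.absolutelyContinuous hab).continuousOn

theorem ae_hasDerivAt (hab : a ≤ b) (hu : IsPrimitive a b u g) :
    ∀ᵐ x, x ∈ uIcc a b → HasDerivAt u (g x) x := by
  filter_upwards [hu.intervalIntegrable.ae_hasDerivAt_integral,
    compl_mem_ae_iff.mpr (measure_singleton a), compl_mem_ae_iff.mpr (measure_singleton b)]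
    with x hx hxa hxb hxI
  have h1 := (hx hxI a (by simp)).const_add (u a)
  rw [uIcc_of_le hab] at hxI
  refine h1.congr_of_eventuallyEq ?_
  have : Ioo a b ∈ 𝓝 x := Ioo_mem_nhds (lt_of_le_of_ne hxI.1 (Ne.symm hxa))
    (lt_of_le_of_ne hxI.2 hxb)
  filter_upwards [this] with y hy
  exact hu.eq_add_integral y ⟨hy.1.le, hy.2.le⟩

/-- The difference from `∫ g` is absolutely continuous with zero derivative almost everywhere, hence
constant. Product, inverse and sum rules all reduce to this criterion and pointwise differentiation.
-/
theorem of_absolutelyContinuous (hab : a ≤ b) (hu : AbsolutelyContinuousOnInterval u a b)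
    (hg : IntervalIntegrable g volume a b)
    (hd : ∀ᵐ x, x ∈ uIcc a b → HasDerivAt u (g x) x) : IsPrimitive a b u g := by
  have hp : IsPrimitive a b (fun x => ∫ t in a..x, g t) g := ⟨hg, fun x _ => by simp⟩
  obtain ⟨C, hC⟩ := (hu.sub (hp.absolutelyContinuous hab)).const_of_ae_hasDerivAt_zero (by
    filter_upwards [hd, hp.ae_hasDerivAt hab] with x h1 h2 hx
    simpa using (h1 hx).sub (h2 hx))
  refine ⟨hg, fun x hx => ?_⟩
  have h1 := hC x (by rwa [uIcc_of_le hab])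
  have h2 := hC a (by simp)
  simp only [Pi.sub_apply, intervalIntegral.integral_same, sub_zero] at h1 h2
  rw [h2, ← h1]; ring

theorem mul (hab : a ≤ b) (hu : IsPrimitive a b u g) (hv : IsPrimitive a b v h) :
    IsPrimitive a b (fun x => u x * v x) (fun x => g x * v x + u x * h x) := by
  have cu := hu.continuousOn hab
  have cv := hv.continuousOn hab
  rw [← uIcc_of_le hab] at cu cv
  refine of_absolutelyContinuous hab
    ((hu.absolutelyContinuous hab).smul (hv.absolutelyContinuous hab))
    ((hu.intervalIntegrable.mul_continuousOn cv).add
      (hv.intervalIntegrable.continuousOn_mul cu)) ?_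
  filter_upwards [hu.ae_hasDerivAt hab, hv.ae_hasDerivAt hab] with x h1 h2 hx
  exact (h1 hx).mul (h2 hx)

theorem inv (hab : a ≤ b) (hu : IsPrimitive a b u g) (h0 : ∀ x ∈ Icc a b, u x ≠ 0) :
    IsPrimitive a b (fun x => (u x)⁻¹) (fun x => -g x / u x ^ 2) := by
  have cu := hu.continuousOn hab
  have ci : ContinuousOn (fun x => (u x)⁻¹) (Icc a b) := cu.inv₀ h0
  obtain ⟨C, hC⟩ := isCompact_Icc.exists_bound_of_continuousOn ci
  rw [← uIcc_of_le hab] at cu ci h0 hC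
  -- Inversion is Lipschitz on the range of `u`, since `1/u - 1/v = (v - u)/(u v)` and `1/u` is
  -- bounded by `C` on the compact interval.
  refine of_absolutelyContinuous hab (absolutelyContinuousOnInterval_of_dist_le (C := C * C)
    (hu.absolutelyContinuous hab) ?_) ?_ ?_
  · intro x hx y hy
    rw [dist_eq_norm, dist_comm, dist_eq_norm]
    have : (u x)⁻¹ - (u y)⁻¹ = (u x)⁻¹ * (u y)⁻¹ * (u y - u x) := by
      have := h0 x hx
      have := h0 y hy
      field_simp
    rw [this, norm_mul, norm_mul]
    have h1 := hC x hx
    have h2 := hC y hy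
    gcongr
    exact (norm_nonneg _).trans h1
  · have : (fun x => -g x / u x ^ 2) = fun x => g x * (-(u x)⁻¹ ^ 2) := by
      ext x; rw [inv_pow]; ring
    rw [this]
    exact hu.intervalIntegrable.mul_continuousOn (ci.pow 2).neg
  · filter_upwards [hu.ae_hasDerivAt hab] with x h1 hx
    exact (h1 hx).inv (h0 x hx)

theorem congr (hab : a ≤ b) (hu : IsPrimitive a b u g) (huv : ∀ x ∈ Icc a b, v x = u x)
    (hgh : g =ᵐ[volume.restrict (Ioo a b)] h) : IsPrimitive a b v h := by
  have h1 : ∀ᵐ x, x ∈ Ioo a b → g x = h x := (ae_restrict_iff' measurableSet_Ioo).1 hgh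
  have h2 : ∀ᵐ x, x ∈ Ioc a b → g x = h x := by
    filter_upwards [h1, compl_mem_ae_iff.mpr (measure_singleton b)] with x hx hxb hI
    exact hx ⟨hI.1, lt_of_le_of_ne hI.2 hxb⟩
  refine ⟨?_, fun x hx => ?_⟩
  · refine hu.intervalIntegrable.congr_ae ?_
    rw [uIoc_of_le hab]
    exact (ae_restrict_iff' measurableSet_Ioc).2 h2
  · rw [huv x hx, huv a ⟨le_rfl, hab⟩, hu.eq_add_integral x hx]
    congr 1
    refine intervalIntegral.integral_congr_ae ?_
    filter_upwards [h2] with y hy hI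
    rw [uIoc_of_le hx.1] at hI
    exact hy ⟨hI.1, hI.2.trans hx.2⟩

theorem add (hab : a ≤ b) (hu : IsPrimitive a b u g) (hv : IsPrimitive a b v h) :
    IsPrimitive a b (fun x => u x + v x) (fun x => g x + h x) := by
  refine of_absolutelyContinuous hab
    ((hu.absolutelyContinuous hab).add (hv.absolutelyContinuous hab))
    (hu.intervalIntegrable.add hv.intervalIntegrable) ?_
  filter_upwards [hu.ae_hasDerivAt hab, hv.ae_hasDerivAt hab] with x h1 h2 hx
  exact (h1 hx).add (h2 hx)

theorem const_mul (hu : IsPrimitive a b u g) (c : ℂ) :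
    IsPrimitive a b (fun x => c * u x) (fun x => c * g x) := by
  refine ⟨hu.intervalIntegrable.const_mul c, fun x hx => ?_⟩
  rw [hu.eq_add_integral x hx, intervalIntegral.integral_const_mul]; ring

theorem of_hasDerivAt (hd : ∀ x, HasDerivAt u (g x) x) (hg : Continuous g) :
    IsPrimitive a b u g := by
  refine ⟨hg.intervalIntegrable a b, fun x hx => ?_⟩
  rw [intervalIntegral.integral_eq_sub_of_hasDerivAt (fun x _ => hd x)
    (hg.intervalIntegrable a x)]
  ring

end IsPrimitive

end DistSchrodinger

/-! ### Weak derivatives, the du Bois-Reymond lemma and continuous representatives. -/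

namespace DistSchrodinger

theorem setIntegral_Ioo_eq {a b : ℝ} (hab : a ≤ b) (g : ℝ → ℂ) :
    ∫ x in Ioo a b, g x = ∫ x in a..b, g x := by
  rw [intervalIntegral.integral_of_le hab, integral_Ioc_eq_integral_Ioo]

theorem LocallyIntegrableOn.integrable_mul_of_tsupport_subset {a b : ℝ} {g φ : ℝ → ℂ}
    (hg : LocallyIntegrableOn g (Ioo a b)) (hφ : Continuous φ) (hc : HasCompactSupport φ)
    (hs : tsupport φ ⊆ Ioo a b) : Integrable (fun x => g x * φ x) := by
  have h1 : IntegrableOn g (tsupport φ) := hg.integrableOn_compact_subset hs hc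
  have h2 : IntegrableOn (fun x => g x * φ x) (tsupport φ) :=
    h1.mul_continuousOn hφ.continuousOn hc
  refine (integrableOn_iff_integrable_of_support_subset ?_).1 h2
  exact fun x hx => subset_tsupport φ (right_ne_zero_of_mul hx)

namespace IsPrimitive

variable {a b : ℝ} {u v g h : ℝ → ℂ}

theorem integrableOn (hab : a ≤ b) (hu : IsPrimitive a b u g) : IntegrableOn g (Ioo a b) :=
  ((intervalIntegrable_iff_integrableOn_Ioo_of_le hab).1 hu.intervalIntegrable)

theorem integral_add_integral (hab : a ≤ b) (hu : IsPrimitive a b u g)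
    (hv : IsPrimitive a b v h) :
    (∫ x in Ioo a b, g x * v x) + ∫ x in Ioo a b, u x * h x = u b * v b - u a * v a := by
  have cu := hu.continuousOn hab
  have cv := hv.continuousOn hab
  rw [← uIcc_of_le hab] at cu cv
  rw [setIntegral_Ioo_eq hab, setIntegral_Ioo_eq hab, ← intervalIntegral.integral_add
    (hu.intervalIntegrable.mul_continuousOn cv) (hv.intervalIntegrable.continuousOn_mul cu)]
  exact ((hu.mul hab hv).sub_eq_integral ⟨le_rfl, hab⟩ ⟨hab, le_rfl⟩).symm

end IsPrimitive

theorem IsTestFunction.apply_left {a b : ℝ} {φ : ℝ → ℂ} (h : IsTestFunction a b φ) : φ a = 0 :=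
  image_eq_zero_of_notMem_tsupport fun h' => lt_irrefl _ (h.2.2 h').1

theorem IsTestFunction.apply_right {a b : ℝ} {φ : ℝ → ℂ} (h : IsTestFunction a b φ) : φ b = 0 :=
  image_eq_zero_of_notMem_tsupport fun h' => lt_irrefl _ (h.2.2 h').2

theorem IsTestFunction.isPrimitive {a b : ℝ} {φ : ℝ → ℂ} (h : IsTestFunction a b φ) :
    IsPrimitive a b φ (deriv φ) :=
  .of_hasDerivAt (fun x => (h.1.differentiable (by simp) x).hasDerivAt)
    (h.1.continuous_deriv (by simp))

theorem IsPrimitive.hasWeakDeriv {a b : ℝ} {u g : ℝ → ℂ} (hab : a ≤ b)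
    (hu : IsPrimitive a b u g) : HasWeakDeriv a b u g := by
  refine ⟨((hu.continuousOn hab).mono Ioo_subset_Icc_self).locallyIntegrableOn measurableSet_Ioo,
    (hu.integrableOn hab).locallyIntegrableOn, fun φ hφ => ?_⟩
  have := hu.integral_add_integral hab hφ.isPrimitive
  rw [hφ.apply_left, hφ.apply_right, mul_zero, mul_zero, sub_zero] at this
  exact eq_neg_of_add_eq_zero_right this

theorem isTestFunction_ofReal {a b : ℝ} {η : ℝ → ℝ} (h1 : ContDiff ℝ ∞ η)
    (h2 : HasCompactSupport η) (h3 : tsupport η ⊆ Ioo a b) :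
    IsTestFunction a b (fun x => (η x : ℂ)) := by
  have hs : Function.support (fun x => (η x : ℂ)) = Function.support η := by
    ext x; simp
  have ht : tsupport (fun x => (η x : ℂ)) = tsupport η := by rw [tsupport, tsupport, hs]
  refine ⟨Complex.ofRealCLM.contDiff.comp h1, ?_, ht ▸ h3⟩
  rw [HasCompactSupport, ht]; exact h2

theorem ae_eq_zero_of_forall_integral_mul_test {a b : ℝ} {u : ℝ → ℂ}
    (hu : LocallyIntegrableOn u (Ioo a b))
    (h : ∀ φ, IsTestFunction a b φ → ∫ x in Ioo a b, u x * φ x = 0) :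
    u =ᵐ[volume.restrict (Ioo a b)] 0 := by
  refine (ae_restrict_iff' measurableSet_Ioo).2
    (isOpen_Ioo.ae_eq_zero_of_integral_contDiff_smul_eq_zero hu fun g h1 h2 h3 => ?_)
  rw [← h _ (isTestFunction_ofReal h1 h2 h3), setIntegral_eq_integral_of_forall_compl_eq_zero]
  · refine integral_congr_ae (.of_forall fun x => ?_)
    simp [mul_comm]
  · intro x hx
    simp [image_eq_zero_of_notMem_tsupport fun h' => hx (h3 h')]

theorem HasWeakDeriv.ae_eq {a b : ℝ} {u v g h : ℝ → ℂ} (hu : HasWeakDeriv a b u g)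
    (hv : HasWeakDeriv a b v h) (huv : u =ᵐ[volume.restrict (Ioo a b)] v) :
    g =ᵐ[volume.restrict (Ioo a b)] h := by
  have : (fun x => g x - h x) =ᵐ[volume.restrict (Ioo a b)] 0 := by
    refine ae_eq_zero_of_forall_integral_mul_test (hu.2.1.sub hv.2.1) fun φ hφ => ?_
    have i1 := (LocallyIntegrableOn.integrable_mul_of_tsupport_subset hu.2.1
      hφ.1.continuous hφ.2.1 hφ.2.2).integrableOn (s := Ioo a b)
    have i2 := (LocallyIntegrableOn.integrable_mul_of_tsupport_subset hv.2.1
      hφ.1.continuous hφ.2.1 hφ.2.2).integrableOn (s := Ioo a b)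
    simp only [sub_mul]
    rw [integral_sub i1 i2, ← neg_eq_iff_eq_neg.2 (hu.2.2 φ hφ),
      ← neg_eq_iff_eq_neg.2 (hv.2.2 φ hφ), sub_eq_zero, neg_inj]
    refine integral_congr_ae ?_
    filter_upwards [huv] with x hx
    rw [hx]
  filter_upwards [this] with x hx
  exact sub_eq_zero.1 hx

/-- A test function with zero mean is the derivative of a test function. -/
theorem exists_test_deriv_eq {a b : ℝ} {ψ : ℝ → ℝ} (h1 : ContDiff ℝ ∞ ψ)
    (h2 : HasCompactSupport ψ) (h3 : tsupport ψ ⊆ Ioo a b) (h4 : ∫ x, ψ x = 0) :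
    ∃ φ, IsTestFunction a b φ ∧ ∀ x, deriv φ x = (ψ x : ℂ) := by
  rcases (tsupport ψ).eq_empty_or_nonempty with he | hne
  · have : ψ = 0 := tsupport_eq_empty_iff.1 he
    refine ⟨0, ⟨contDiff_const, HasCompactSupport.zero, by simp [tsupport]⟩, fun x => ?_⟩
    simp [this]
  obtain ⟨c, hc, hcl⟩ := IsCompact.exists_isLeast h2 hne
  obtain ⟨d, hd, hdg⟩ := IsCompact.exists_isGreatest h2 hne
  have hψ0 : ∀ x, x ∉ Icc c d → ψ x = 0 := fun x hx =>
    image_eq_zero_of_notMem_tsupport fun h' => hx ⟨hcl h', hdg h'⟩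
  have hac := (h3 hc).1
  have hdb := (h3 hd).2
  have hcont := h1.continuous
  let Φ : ℝ → ℝ := fun x => ∫ t in a..x, ψ t
  have hd : ∀ x, HasDerivAt Φ (ψ x) x := fun x => hcont.integral_hasStrictDerivAt a x |>.hasDerivAt
  have hΦ : ContDiff ℝ ∞ Φ := by
    rw [contDiff_infty_iff_deriv]
    refine ⟨fun x => (hd x).differentiableAt, ?_⟩
    have : deriv Φ = ψ := funext fun x => (hd x).deriv
    rwa [this]
  -- To the left of the support of `ψ` the integrand vanishes; to its right the integral is the full
  -- mean of `ψ`, which is zero.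
  have hΦs : Function.support Φ ⊆ Icc c d := by
    intro x hx
    by_contra hxI
    apply hx
    by_cases hxc : x < c
    · refine (intervalIntegral.integral_congr (g := fun _ => 0) fun t ht => ?_).trans (by simp)
      refine hψ0 t fun ht' => ?_
      rcases uIcc_subset_Icc (a₂ := min a x) (b₂ := max a x) ⟨min_le_left _ _, le_max_left _ _⟩
        ⟨min_le_right _ _, le_max_right _ _⟩ ht with ⟨_, h6⟩
      rcases le_max_iff.1 h6 with h7 | h7 <;> linarith [ht'.1]
    · have hxd : d < x := by
        by_contra h'; exact hxI ⟨not_lt.1 hxc, not_lt.1 h'⟩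
      change ∫ t in a..x, ψ t = 0
      rw [intervalIntegral.integral_eq_integral_of_support_subset, h4]
      intro t ht
      have : t ∈ Icc c d := by by_contra h'; exact ht (hψ0 t h')
      exact ⟨hac.trans_le this.1, this.2.trans hxd.le⟩
  have hΦt : tsupport Φ ⊆ Icc c d := closure_minimal hΦs isClosed_Icc
  refine ⟨fun x => (Φ x : ℂ), isTestFunction_ofReal hΦ
    (isCompact_Icc.of_isClosed_subset (isClosed_tsupport _) hΦt)
    (hΦt.trans fun x hx => ⟨hac.trans_le hx.1, hx.2.trans_lt hdb⟩), fun x => ?_⟩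
  exact (hd x).ofReal_comp.deriv

/-- The lemma of du Bois-Reymond. -/
theorem ae_eq_const_of_forall_integral_mul_deriv_test {a b : ℝ} (hab : a < b) {w : ℝ → ℂ}
    (hw : LocallyIntegrableOn w (Ioo a b))
    (h : ∀ φ, IsTestFunction a b φ → ∫ x in Ioo a b, w x * deriv φ x = 0) :
    ∃ c : ℂ, w =ᵐ[volume.restrict (Ioo a b)] fun _ => c := by
  -- A bump `θ` of mass one inside the interval: for any `η` the function `η - (∫ η) θ` has zero
  -- mean, so it is an admissible derivative. This identifies the constant as `∫ w θ`.
  let f : ContDiffBump ((a + b) / 2) := ⟨(b - a) / 8, (b - a) / 4, by linarith, by linarith⟩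
  let θ : ℝ → ℝ := f.normed volume
  have hθ1 : ContDiff ℝ ∞ θ := f.contDiff_normed
  have hθ2 : HasCompactSupport θ := f.hasCompactSupport_normed
  have hθ3 : tsupport θ ⊆ Ioo a b := by
    rw [show tsupport θ = _ from f.tsupport_normed_eq (μ := volume), Real.closedBall_eq_Icc]
    intro x hx
    have : f.rOut = (b - a) / 4 := rfl
    rw [this] at hx
    exact ⟨by linarith [hx.1], by linarith [hx.2]⟩
  have hθ4 : ∫ x, θ x = 1 := f.integral_normed
  have hθt := isTestFunction_ofReal hθ1 hθ2 hθ3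
  refine ⟨∫ x in Ioo a b, w x * θ x, ?_⟩
  set C := ∫ x in Ioo a b, w x * θ x with hC
  have hl : LocallyIntegrableOn (fun x => w x - C) (Ioo a b) :=
    hw.sub (continuousOn_const.locallyIntegrableOn measurableSet_Ioo)
  have h0 : ∀ᵐ x, x ∈ Ioo a b → w x - C = 0 := by
    refine isOpen_Ioo.ae_eq_zero_of_integral_contDiff_smul_eq_zero hl fun η h1 h2 h3 => ?_
    have hηt := isTestFunction_ofReal h1 h2 h3
    obtain ⟨φ, hφ, hφ'⟩ := exists_test_deriv_eq (a := a) (b := b)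
      (ψ := fun x => η x - (∫ y, η y) * θ x) (h1.sub (contDiff_const.mul hθ1))
      (h2.sub (hθ2.mul_left)) ((tsupport_sub _ _).trans (union_subset h3
        ((tsupport_mul_subset_right (f := fun _ => ∫ y, η y) (g := θ)).trans hθ3)))
      (by
        rw [integral_sub (h1.continuous.integrable_of_hasCompactSupport h2)
          ((hθ1.continuous.integrable_of_hasCompactSupport hθ2).const_mul _),
          integral_const_mul, hθ4]; ring)
    have i1 := LocallyIntegrableOn.integrable_mul_of_tsupport_subset hw hηt.1.continuous
      hηt.2.1 hηt.2.2
    have i2 := LocallyIntegrableOn.integrable_mul_of_tsupport_subset hw hθt.1.continuous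
      hθt.2.1 hθt.2.2
    have h5 := h φ hφ
    have h6 : ∫ x in Ioo a b, w x * deriv φ x
        = (∫ x in Ioo a b, w x * η x) - (∫ y, η y : ℝ) * C := by
      rw [hC, ← integral_const_mul, ← integral_sub i1.integrableOn
        (i2.integrableOn.const_mul _)]
      refine integral_congr_ae (.of_forall fun x => ?_)
      simp only [hφ']
      push_cast
      ring
    have h7 : ∫ x in Ioo a b, w x * η x = ∫ x, w x * η x :=
      setIntegral_eq_integral_of_forall_compl_eq_zero fun x hx => by
        simp [image_eq_zero_of_notMem_tsupport fun h' => hx (h3 h')]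
    have h8 : ∫ x, η x • (w x - C) = (∫ x, w x * η x) - (∫ y, η y : ℝ) * C := by
      rw [← integral_complex_ofReal, ← integral_mul_const, ← integral_sub i1
        ((hηt.1.continuous.integrable_of_hasCompactSupport hηt.2.1).mul_const C)]
      refine integral_congr_ae (.of_forall fun x => ?_)
      simp only [Complex.real_smul]
      ring
    rw [h8, ← h7, ← h6, h5]
  filter_upwards [(ae_restrict_iff' measurableSet_Ioo).2 h0] with x hx
  exact sub_eq_zero.1 hx

/-- Subtracting `∫ g` leaves a function with zero weak derivative, which is constant by du
Bois-Reymond. It turns weak statements into the calculus of primitives. -/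
theorem HasWeakDeriv.exists_isPrimitive {a b : ℝ} (hab : a < b) {u g : ℝ → ℂ}
    (hu : HasWeakDeriv a b u g) (hg : IntegrableOn g (Ioo a b)) :
    ∃ v, IsPrimitive a b v g ∧ u =ᵐ[volume.restrict (Ioo a b)] v := by
  have hgi : IntervalIntegrable g volume a b :=
    (intervalIntegrable_iff_integrableOn_Ioo_of_le hab.le).2 hg
  have hp : IsPrimitive a b (fun x => ∫ t in a..x, g t) g := ⟨hgi, fun x _ => by simp⟩
  have hpw := hp.hasWeakDeriv hab.le
  obtain ⟨c, hc⟩ := ae_eq_const_of_forall_integral_mul_deriv_test hab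
    (w := fun x => u x - ∫ t in a..x, g t) (hu.1.sub hpw.1) fun φ hφ => by
      have hφ' : Continuous (deriv φ) := hφ.1.continuous_deriv (by simp)
      have i1 := LocallyIntegrableOn.integrable_mul_of_tsupport_subset hu.1 hφ'
        hφ.2.1.deriv ((tsupport_deriv_subset).trans hφ.2.2)
      have i2 := LocallyIntegrableOn.integrable_mul_of_tsupport_subset hpw.1 hφ'
        hφ.2.1.deriv ((tsupport_deriv_subset).trans hφ.2.2)
      simp only [sub_mul]
      rw [integral_sub i1.integrableOn i2.integrableOn, hu.2.2 φ hφ, hpw.2.2 φ hφ, sub_self]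
  refine ⟨fun x => c + ∫ t in a..x, g t, ⟨hgi, fun x _ => by simp⟩, ?_⟩
  filter_upwards [hc] with x hx
  rw [← hx]; ring

theorem HasWeakDeriv.congr {a b : ℝ} {u v g : ℝ → ℂ} (hu : HasWeakDeriv a b u g)
    (huv : u =ᵐ[volume.restrict (Ioo a b)] v) (hv : LocallyIntegrableOn v (Ioo a b)) :
    HasWeakDeriv a b v g := by
  refine ⟨hv, hu.2.1, fun φ hφ => ?_⟩
  rw [← hu.2.2 φ hφ]
  refine integral_congr_ae ?_
  filter_upwards [huv] with x hx
  rw [hx]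

theorem weakDeriv_spec {a b : ℝ} {u g : ℝ → ℂ} (hu : HasWeakDeriv a b u g) :
    HasWeakDeriv a b u (weakDeriv a b u) := by
  have : ∃ g, HasWeakDeriv a b u g := ⟨g, hu⟩
  rw [weakDeriv, dif_pos this]
  exact this.choose_spec

theorem MemL2.integrableOn {a b : ℝ} {g : ℝ → ℂ} (hg : MemL2 a b g) :
    IntegrableOn g (Ioo a b) :=
  MemLp.integrable (q := 2) (by norm_num) hg

theorem _root_.ContinuousOn.memL2 {a b : ℝ} {u : ℝ → ℂ} (hu : ContinuousOn u (Icc a b)) :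
    MemL2 a b u := by
  obtain ⟨C, hC⟩ := isCompact_Icc.exists_bound_of_continuousOn hu
  refine MemLp.of_bound ((hu.mono Ioo_subset_Icc_self).aestronglyMeasurable measurableSet_Ioo) C ?_
  exact (ae_restrict_iff' measurableSet_Ioo).2
    (.of_forall fun x hx => hC x (Ioo_subset_Icc_self hx))

theorem MemL2.mul_continuousOn {a b : ℝ} {g u : ℝ → ℂ} (hg : MemL2 a b g)
    (hu : ContinuousOn u (Icc a b)) : MemL2 a b (fun x => u x * g x) := by
  obtain ⟨C, hC⟩ := isCompact_Icc.exists_bound_of_continuousOn hu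
  have hm := (hu.mono Ioo_subset_Icc_self).aestronglyMeasurable (μ := volume) measurableSet_Ioo
  refine MemLp.of_le_mul (c := C) hg (hm.mul hg.1) ?_
  refine (ae_restrict_iff' measurableSet_Ioo).2 (.of_forall fun x hx => ?_)
  rw [norm_mul]
  gcongr
  exact hC x (Ioo_subset_Icc_self hx)

theorem IsPrimitive.memW12 {a b : ℝ} {u v g : ℝ → ℂ} (hab : a ≤ b) (hv : IsPrimitive a b v g)
    (hg : MemL2 a b g) (huv : u =ᵐ[volume.restrict (Ioo a b)] v) : MemW12 a b u := by
  have hu : MemL2 a b u := (hv.continuousOn hab).memL2.ae_eq huv.symm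
  exact ⟨hu, g, hg, (hv.hasWeakDeriv hab).congr huv.symm hu.integrableOn.locallyIntegrableOn⟩

theorem IsPrimitive.weakDeriv_ae_eq {a b : ℝ} {u v g : ℝ → ℂ} (hab : a ≤ b)
    (hv : IsPrimitive a b v g) (huv : u =ᵐ[volume.restrict (Ioo a b)] v) :
    weakDeriv a b u =ᵐ[volume.restrict (Ioo a b)] g := by
  have hw := hv.hasWeakDeriv hab
  have hu : LocallyIntegrableOn u (Ioo a b) :=
    IntegrableOn.locallyIntegrableOn ((hv.continuousOn hab).memL2.integrableOn.congr huv.symm)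
  exact (weakDeriv_spec (hw.congr huv.symm hu)).ae_eq hw huv

theorem MemW12.exists_isPrimitive {a b : ℝ} (hab : a < b) {u : ℝ → ℂ} (hu : MemW12 a b u) :
    MemL2 a b (weakDeriv a b u) ∧
      ∃ v, IsPrimitive a b v (weakDeriv a b u) ∧ u =ᵐ[volume.restrict (Ioo a b)] v := by
  obtain ⟨h1, g, h2, h3⟩ := hu
  have h4 := weakDeriv_spec h3
  have h5 : MemL2 a b (weakDeriv a b u) := h2.ae_eq (h3.ae_eq h4 (ae_eq_refl _))
  exact ⟨h5, h4.exists_isPrimitive hab h5.integrableOn⟩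

theorem MemW12.isPrimitive_of_continuousOn {a b : ℝ} (hab : a < b) {u : ℝ → ℂ}
    (hu : MemW12 a b u) (hc : ContinuousOn u (Icc a b)) :
    IsPrimitive a b u (weakDeriv a b u) := by
  obtain ⟨_, v, h2, h3⟩ := hu.exists_isPrimitive hab
  have h4 := Measure.eqOn_Icc_of_ae_eq volume hab.ne (by rwa [restrict_Ioo_eq_restrict_Icc] at h3)
    hc (h2.continuousOn hab.le)
  exact h2.congr hab.le h4 (ae_eq_refl _)

theorem MemW12Zero.exists_isPrimitive {a b : ℝ} (hab : a < b) {u : ℝ → ℂ}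
    (hu : MemW12Zero a b u) : MemL2 a b (weakDeriv a b u) ∧
      ∃ v, IsPrimitive a b v (weakDeriv a b u) ∧ u =ᵐ[volume.restrict (Ioo a b)] v ∧
        v a = 0 ∧ v b = 0 := by
  obtain ⟨h1, v, h2, h3, h4, h5⟩ := hu
  obtain ⟨h6, v', h7, h8⟩ := h1.exists_isPrimitive hab
  have h9 := Measure.eqOn_Icc_of_ae_eq volume hab.ne
    (by rw [← restrict_Ioo_eq_restrict_Icc]; exact h3.symm.trans h8) h2 (h7.continuousOn hab.le)
  exact ⟨h6, v, h7.congr hab.le h9 (ae_eq_refl _), h3, h4, h5⟩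

theorem IsPrimitive.memW12Zero {a b : ℝ} {u v g : ℝ → ℂ} (hab : a ≤ b) (hv : IsPrimitive a b v g)
    (hg : MemL2 a b g) (huv : u =ᵐ[volume.restrict (Ioo a b)] v) (ha : v a = 0) (hb : v b = 0) :
    MemW12Zero a b u :=
  ⟨hv.memW12 hab hg huv, v, hv.continuousOn hab, huv, ha, hb⟩

end DistSchrodinger

/-! ### Miura form of the potential and factorization of the Schrödinger operator. -/

namespace DistSchrodinger

theorem MemL2.integrableOn_mul {a b : ℝ} {u v : ℝ → ℂ} (hu : MemL2 a b u) (hv : MemL2 a b v) :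
    IntegrableOn (fun x => u x * v x) (Ioo a b) :=
  MemLp.integrable_mul hu hv

theorem MemL2.sub {a b : ℝ} {u v : ℝ → ℂ} (hu : MemL2 a b u) (hv : MemL2 a b v) :
    MemL2 a b (fun x => u x - v x) :=
  MemLp.sub hu hv

theorem MemL2.neg {a b : ℝ} {u : ℝ → ℂ} (hu : MemL2 a b u) : MemL2 a b (fun x => -u x) :=
  MemLp.neg hu

/-- Here `q` acts on functions rather than on classes. A null function has zero Sobolev norm, so
boundedness makes `q` vanish on `φ - ψ`. -/
theorem IsNegSobolev.congr {a b : ℝ} (hab : a < b) {q : (ℝ → ℂ) → ℂ} (hq : IsNegSobolev a b q)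
    {φ ψ : ℝ → ℂ} (hψ : MemW12Zero a b ψ)
    (h : φ =ᵐ[volume.restrict (Ioo a b)] ψ) : q φ = q ψ := by
  have h0 : φ - ψ =ᵐ[volume.restrict (Ioo a b)] fun _ => 0 := by
    filter_upwards [h] with x hx
    simp [hx]
  have hp : IsPrimitive a b (fun _ => 0) (fun _ => 0) := ⟨by simp, by simp⟩
  have hd : MemW12Zero a b (φ - ψ) :=
    hp.memW12Zero hab.le (continuousOn_const.memL2) h0 rfl rfl
  have hw := hp.weakDeriv_ae_eq hab.le h0
  have hn : normW12 a b (φ - ψ) = 0 := by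
    have e1 : ∫ x in Ioo a b, ‖(φ - ψ) x‖ ^ 2 = 0 :=
      integral_eq_zero_of_ae (by filter_upwards [h0] with x hx; simp [hx])
    have e2 : ∫ x in Ioo a b, ‖weakDeriv a b (φ - ψ) x‖ ^ 2 = 0 :=
      integral_eq_zero_of_ae (by filter_upwards [hw] with x hx; simp [hx])
    rw [normW12, e1, e2]; simp
  obtain ⟨C, hC⟩ := hq.bounded
  have h1 := hC _ hd
  rw [hn, mul_zero] at h1
  have h2 := hq.map_add _ _ hd hψ
  rw [sub_add_cancel, norm_le_zero_iff.1 h1, zero_add] at h2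
  exact h2

/-- `f` is nonvanishing on `[0,ℓ]` with `f(0) = 1` and logarithmic derivative `p ∈ L²(0,ℓ)`. -/
structure IsExpPrimitive (ℓ : ℝ) (f p : ℝ → ℂ) : Prop where
  isPrimitive : IsPrimitive 0 ℓ f (fun x => p x * f x)
  memL2 : MemL2 0 ℓ p
  ne_zero : ∀ x ∈ Icc 0 ℓ, f x ≠ 0
  init : f 0 = 1

/-- On `W₀^{1,2}(0,ℓ)` the functional `q` is the distribution `p² + p'`. -/
def IsMiura (ℓ : ℝ) (q : (ℝ → ℂ) → ℂ) (p : ℝ → ℂ) : Prop :=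
  ∀ φ, MemW12Zero 0 ℓ φ →
    q φ = ∫ x in Ioo 0 ℓ, (p x ^ 2 * φ x - p x * weakDeriv 0 ℓ φ x)

section
variable {ℓ : ℝ} {f p : ℝ → ℂ} {q : (ℝ → ℂ) → ℂ}

theorem IsExpPrimitive.continuousOn (hℓ : 0 < ℓ) (hf : IsExpPrimitive ℓ f p) :
    ContinuousOn f (Icc 0 ℓ) := hf.isPrimitive.continuousOn hℓ.le

theorem IsExpPrimitive.continuousOn_inv (hℓ : 0 < ℓ) (hf : IsExpPrimitive ℓ f p) :
    ContinuousOn (fun x => (f x)⁻¹) (Icc 0 ℓ) := (hf.continuousOn hℓ).inv₀ hf.ne_zero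

theorem IsExpPrimitive.inv (hℓ : 0 < ℓ) (hf : IsExpPrimitive ℓ f p) :
    IsExpPrimitive ℓ f⁻¹ (-p) := by
  refine ⟨(hf.isPrimitive.inv hℓ.le hf.ne_zero).congr hℓ.le (fun x _ => rfl) ?_, hf.memL2.neg,
    fun x hx => inv_ne_zero (hf.ne_zero x hx), by simp [hf.init]⟩
  filter_upwards [ae_restrict_mem measurableSet_Ioo] with x hx
  have := hf.ne_zero x (Ioo_subset_Icc_self hx)
  simp only [Pi.neg_apply, Pi.inv_apply]
  field_simp

theorem IsExpPrimitive.div (hℓ : 0 < ℓ) (hf : IsExpPrimitive ℓ f p) {y y' : ℝ → ℂ}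
    (hy : IsPrimitive 0 ℓ y y') :
    IsPrimitive 0 ℓ (fun x => y x / f x) (fun x => (y' x - p x * y x) / f x) := by
  refine (hy.mul hℓ.le (hf.inv hℓ).isPrimitive).congr hℓ.le
    (fun x _ => by simp [div_eq_mul_inv]) ?_
  filter_upwards with x
  simp only [Pi.neg_apply, Pi.inv_apply]
  ring

theorem IsExpPrimitive.opD_ae_eq (hℓ : 0 < ℓ) (hf : IsExpPrimitive ℓ f p) {Y y y' : ℝ → ℂ}
    (hy : IsPrimitive 0 ℓ y y') (hY : Y =ᵐ[volume.restrict (Ioo 0 ℓ)] y) :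
    opD 0 ℓ f Y =ᵐ[volume.restrict (Ioo 0 ℓ)] fun x => y' x - p x * y x := by
  have h1 := (hf.div hℓ hy).weakDeriv_ae_eq hℓ.le (u := fun s => Y s / f s) (by
    filter_upwards [hY] with x hx
    rw [hx])
  filter_upwards [h1, ae_restrict_mem measurableSet_Ioo] with x hx hI
  have := hf.ne_zero x (Ioo_subset_Icc_self hI)
  rw [opD, hx]
  field_simp

theorem IsNonvanishingSolution.isExpPrimitive (hℓ : 0 < ℓ)
    (hf : IsNonvanishingSolution 0 ℓ q f) (hf0 : f 0 = 1) :
    IsExpPrimitive ℓ f (fun x => weakDeriv 0 ℓ f x / f x) := by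
  have h1 := hf.mem_domain.1.isPrimitive_of_continuousOn hℓ hf.continuousOn
  refine ⟨h1.congr hℓ.le (fun _ _ => rfl) ?_, ?_, hf.ne_zero, hf0⟩
  · filter_upwards [ae_restrict_mem measurableSet_Ioo] with x hx
    exact (div_mul_cancel₀ _ (hf.ne_zero x (Ioo_subset_Icc_self hx))).symm
  · have h2 := (hf.mem_domain.1.exists_isPrimitive hℓ).1.mul_continuousOn
      (hf.continuousOn.inv₀ hf.ne_zero)
    simpa only [div_eq_inv_mul, Pi.inv_apply] using h2

/-- The test function `φ / f` in `S_q f = 0` isolates `q φ = -∫ f' (φ/f)'`; expanding the quotient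
gives the Miura form. -/
theorem IsNonvanishingSolution.isMiura (hℓ : 0 < ℓ) (hq : IsNegSobolev 0 ℓ q)
    (hf : IsNonvanishingSolution 0 ℓ q f) (hf0 : f 0 = 1) :
    IsMiura ℓ q (fun x => weakDeriv 0 ℓ f x / f x) := by
  intro φ hφ
  have he := hf.isExpPrimitive hℓ hf0
  set p := fun x => weakDeriv 0 ℓ f x / f x with hp
  obtain ⟨h1, v, hv, hφv, hv0, hvℓ⟩ := hφ.exists_isPrimitive hℓ
  have h2 := he.div hℓ hv
  have hψ' : MemL2 0 ℓ (fun x => (weakDeriv 0 ℓ φ x - p x * v x) / f x) := by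
    have := (MemL2.sub h1 (he.memL2.mul_continuousOn (hv.continuousOn hℓ.le))).mul_continuousOn
      (he.continuousOn_inv hℓ)
    refine this.ae_eq (.of_forall fun x => ?_)
    ring
  have hae : (fun x => φ x / f x) =ᵐ[volume.restrict (Ioo 0 ℓ)] fun x => v x / f x := by
    filter_upwards [hφv] with x hx
    rw [hx]
  have hψ : MemW12Zero 0 ℓ (fun x => φ x / f x) :=
    h2.memW12Zero hℓ.le hψ' hae (by simp [hv0]) (by simp [hvℓ])
  have h3 := hf.eq_zero.2 _ hψ
  have hw := h2.weakDeriv_ae_eq hℓ.le hae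
  have hprod : (fun x => f x * (φ x / f x)) =ᵐ[volume.restrict (Ioo 0 ℓ)] φ := by
    filter_upwards [ae_restrict_mem measurableSet_Ioo] with x hx
    exact mul_div_cancel₀ _ (hf.ne_zero x (Ioo_subset_Icc_self hx))
  rw [schrodingerPairing, hq.congr hℓ hφ hprod] at h3
  simp only [Pi.zero_apply, zero_mul, integral_zero] at h3
  rw [eq_neg_of_add_eq_zero_right h3, ← integral_neg]
  refine integral_congr_ae ?_
  filter_upwards [hw, hφv, ae_restrict_mem measurableSet_Ioo] with x hx hx2 hI
  have := hf.ne_zero x (Ioo_subset_Icc_self hI)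
  rw [hx, hx2, hp]
  field_simp
  ring

theorem IsExpPrimitive.isMiura_potentialOf (hℓ : 0 < ℓ) (hf : IsExpPrimitive ℓ f p) :
    IsMiura ℓ (potentialOf 0 ℓ f) p := by
  intro φ _
  refine integral_congr_ae ?_
  filter_upwards [hf.isPrimitive.weakDeriv_ae_eq hℓ.le (ae_eq_refl _),
    ae_restrict_mem measurableSet_Ioo] with x hx hI
  have := hf.ne_zero x (Ioo_subset_Icc_self hI)
  rw [hx, mul_div_cancel_right₀ _ this]

/-- `S_q y = -D_{1/f} D_f y` in weak form. -/
theorem IsMiura.schrodingerPairing_eq (hℓ : 0 < ℓ) (hp : MemL2 0 ℓ p) (hq : IsMiura ℓ q p)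
    {Y y y' φ v v' : ℝ → ℂ} (hy : IsPrimitive 0 ℓ y y') (hy' : MemL2 0 ℓ y')
    (hY : Y =ᵐ[volume.restrict (Ioo 0 ℓ)] y) (hv : IsPrimitive 0 ℓ v v') (hv' : MemL2 0 ℓ v')
    (hφ : φ =ᵐ[volume.restrict (Ioo 0 ℓ)] v) (hv0 : v 0 = 0) (hvℓ : v ℓ = 0) :
    schrodingerPairing 0 ℓ q Y φ
      = ∫ x in Ioo 0 ℓ, (y' x - p x * y x) * (v' x - p x * v x) := by
  have cy := hy.continuousOn hℓ.le
  have cv := hv.continuousOn hℓ.le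
  have hm := hy.mul hℓ.le hv
  have hYφ : (fun x => Y x * φ x) =ᵐ[volume.restrict (Ioo 0 ℓ)] fun x => y x * v x := by
    filter_upwards [hY, hφ] with x h1 h2
    rw [h1, h2]
  have hm' : MemL2 0 ℓ (fun x => y' x * v x + y x * v' x) := by
    refine ((hy'.mul_continuousOn cv).add (hv'.mul_continuousOn cy)).ae_eq
      (.of_forall fun x => ?_)
    simp [mul_comm]
  have hz := hm.memW12Zero hℓ.le hm' hYφ (by simp [hv0]) (by simp [hvℓ])
  rw [schrodingerPairing, hq _ hz]
  have e1 : ∫ x in Ioo 0 ℓ, weakDeriv 0 ℓ Y x * weakDeriv 0 ℓ φ x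
      = ∫ x in Ioo 0 ℓ, y' x * v' x := by
    refine integral_congr_ae ?_
    filter_upwards [hy.weakDeriv_ae_eq hℓ.le hY, hv.weakDeriv_ae_eq hℓ.le hφ] with x h1 h2
    rw [h1, h2]
  have e2 : ∫ x in Ioo 0 ℓ, (p x ^ 2 * (Y x * φ x)
        - p x * weakDeriv 0 ℓ (fun x => Y x * φ x) x)
      = ∫ x in Ioo 0 ℓ, ((p x * (y x * v x)) * p x - p x * (y' x * v x + y x * v' x)) := by
    refine integral_congr_ae ?_
    filter_upwards [hm.weakDeriv_ae_eq hℓ.le hYφ, hYφ] with x h1 h2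
    rw [h1, h2]; ring
  rw [e1, e2, ← integral_add]
  · refine integral_congr_ae (.of_forall fun x => ?_)
    ring
  · exact hy'.integrableOn_mul hv'
  · refine Integrable.sub ?_ (hp.integrableOn_mul hm')
    have := (hp.mul_continuousOn (cy.mul cv)).integrableOn_mul hp
    refine Integrable.congr this (.of_forall fun x => ?_)
    simp only [Pi.mul_apply]
    ring

/-- With `B = f D_f y`, the pairing is `∫ B (φ/f)'`, and integration by parts moves the derivative
onto `B`; the boundary terms vanish with `φ`. -/
theorem IsMiura.schrodingerEq_of_isPrimitive (hℓ : 0 < ℓ) (hf : IsExpPrimitive ℓ f p)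
    (hq : IsMiura ℓ q p) {Y y y' g B : ℝ → ℂ} (hy : IsPrimitive 0 ℓ y y') (hy' : MemL2 0 ℓ y')
    (hY : Y =ᵐ[volume.restrict (Ioo 0 ℓ)] y) (hg : MemL2 0 ℓ g)
    (hB : IsPrimitive 0 ℓ B (fun x => -(f x * g x)))
    (hBy : (fun x => f x * (y' x - p x * y x)) =ᵐ[volume.restrict (Ioo 0 ℓ)] B) :
    Y ∈ regularizationDomain 0 ℓ q ∧ SchrodingerEq 0 ℓ q Y g := by
  have hS : SchrodingerEq 0 ℓ q Y g := by
    refine ⟨hg, fun φ hφ => ?_⟩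
    obtain ⟨h1, v, hv, hφv, hv0, hvℓ⟩ := hφ.exists_isPrimitive hℓ
    rw [hq.schrodingerPairing_eq hℓ hf.memL2 hy hy' hY hv h1 hφv hv0 hvℓ]
    have h2 := hB.integral_add_integral hℓ.le (hf.div hℓ hv)
    simp only [hv0, hvℓ, zero_div, mul_zero, sub_zero] at h2
    have e1 : ∫ x in Ioo 0 ℓ, (y' x - p x * y x) * (weakDeriv 0 ℓ φ x - p x * v x)
        = ∫ x in Ioo 0 ℓ, B x * ((weakDeriv 0 ℓ φ x - p x * v x) / f x) := by
      refine integral_congr_ae ?_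
      filter_upwards [hBy, ae_restrict_mem measurableSet_Ioo] with x hx hI
      have := hf.ne_zero x (Ioo_subset_Icc_self hI)
      rw [← hx]
      field_simp
    rw [e1, eq_neg_of_add_eq_zero_right h2, ← integral_neg]
    refine integral_congr_ae ?_
    filter_upwards [hφv, ae_restrict_mem measurableSet_Ioo] with x hx hI
    have := hf.ne_zero x (Ioo_subset_Icc_self hI)
    rw [hx]
    field_simp
  exact ⟨⟨hy.memW12 hℓ.le hy' hY, g, hS⟩, hS⟩

/-- Testing with `f η`, for which `D_f (f η) = f η'`, turns the equation into the weak derivative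
identity for `f D_f y`. -/
theorem IsMiura.exists_isPrimitive_of_schrodingerEq (hℓ : 0 < ℓ) (hf : IsExpPrimitive ℓ f p)
    (hq : IsMiura ℓ q p) {Y y y' g : ℝ → ℂ} (hy : IsPrimitive 0 ℓ y y') (hy' : MemL2 0 ℓ y')
    (hY : Y =ᵐ[volume.restrict (Ioo 0 ℓ)] y) (hS : SchrodingerEq 0 ℓ q Y g) :
    ∃ B, IsPrimitive 0 ℓ B (fun x => -(f x * g x)) ∧
      (fun x => f x * (y' x - p x * y x)) =ᵐ[volume.restrict (Ioo 0 ℓ)] B := by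
  have cf := hf.continuousOn hℓ
  have hfg := hS.1.mul_continuousOn cf
  have hu : MemL2 0 ℓ (fun x => f x * (y' x - p x * y x)) := by
    have := (MemL2.sub hy' (hf.memL2.mul_continuousOn (hy.continuousOn hℓ.le))).mul_continuousOn cf
    refine this.ae_eq (.of_forall fun x => ?_)
    ring
  refine HasWeakDeriv.exists_isPrimitive hℓ ⟨hu.integrableOn.locallyIntegrableOn,
    (MemL2.neg hfg).integrableOn.locallyIntegrableOn, fun η hη => ?_⟩ (MemL2.neg hfg).integrableOn
  have hv := hf.isPrimitive.mul hℓ.le hη.isPrimitive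
  have hv' : MemL2 0 ℓ (fun x => p x * f x * η x + f x * deriv η x) := by
    have h1 := hf.memL2.mul_continuousOn (cf.mul hη.1.continuous.continuousOn)
    have h2 := (cf.mul (hη.1.continuous_deriv (by simp)).continuousOn).memL2
    refine (h1.add h2).ae_eq (.of_forall fun x => ?_)
    simp only [Pi.add_apply, Pi.mul_apply]
    ring
  have h0 := hη.apply_left
  have h1 := hη.apply_right
  have h3 := hS.2 _ (hv.memW12Zero hℓ.le hv' (ae_eq_refl _) (by simp [h0]) (by simp [h1]))
  rw [hq.schrodingerPairing_eq hℓ hf.memL2 hy hy' hY hv hv' (ae_eq_refl _) (by simp [h0])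
    (by simp [h1])] at h3
  rw [← integral_neg]
  convert h3 using 2
  · ext x; ring
  · ext x; ring

end

end DistSchrodinger

/-! ### The first-order system, uniqueness, and the Darboux relation between exponential solutions.
-/

namespace DistSchrodinger

/-- Gronwall's inequality needs a right derivative at every point, not almost everywhere; continuity
of `g` provides it. -/
theorem IsPrimitive.hasDerivWithinAt {a b : ℝ} {u g : ℝ → ℂ} (hu : IsPrimitive a b u g)
    (hg : ContinuousOn g (Icc a b)) {t : ℝ} (ht : t ∈ Ico a b) :
    HasDerivWithinAt u (g t) (Ici t) t := by
  have hmem : Icc a b ∈ 𝓝[>] t := Icc_mem_nhdsGT_of_mem ht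
  have hm : StronglyMeasurableAtFilter g (𝓝[>] t) volume :=
    ⟨Icc a b, hmem, hg.aestronglyMeasurable measurableSet_Icc⟩
  have hc : ContinuousWithinAt g (Ioi t) t :=
    (hg t ⟨ht.1, ht.2.le⟩).mono_of_mem_nhdsWithin hmem
  have h1 := (intervalIntegral.integral_hasDerivWithinAt_right (a := a) (b := t)
    (s := Ici t) (t := Ioi t)
    (hu.intervalIntegrable.mono_set (by
      rw [uIcc_of_le ht.1, uIcc_of_le (ht.1.trans ht.2.le)]; exact Icc_subset_Icc_right ht.2.le))
    hm hc).const_add (u a)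
  refine h1.congr_of_eventuallyEq ?_ (hu.eq_add_integral t ⟨ht.1, ht.2.le⟩)
  have : Icc a b ∈ 𝓝[≥] t := Icc_mem_nhdsGE_of_mem ht
  filter_upwards [this] with x hx
  exact hu.eq_add_integral x hx

/-- Gronwall for the pair `(A, B)` in the sup norm, with rate the larger of the bounds for `m` and
`n`. -/
theorem eqOn_zero_of_linear_system {a b : ℝ} (hab : a ≤ b) {A B m n : ℝ → ℂ}
    (hm : ContinuousOn m (Icc a b)) (hn : ContinuousOn n (Icc a b))
    (hA : IsPrimitive a b A (fun x => m x * B x)) (hB : IsPrimitive a b B (fun x => n x * A x))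
    (hA0 : A a = 0) (hB0 : B a = 0) : ∀ x ∈ Icc a b, A x = 0 ∧ B x = 0 := by
  have cA := hA.continuousOn hab
  have cB := hB.continuousOn hab
  obtain ⟨C, hC⟩ := isCompact_Icc.exists_bound_of_continuousOn hm
  obtain ⟨D, hD⟩ := isCompact_Icc.exists_bound_of_continuousOn hn
  intro x hx
  have h := norm_le_gronwallBound_of_norm_deriv_right_le (f := fun t => (A t, B t))
    (f' := fun t => (m t * B t, n t * A t)) (δ := 0) (K := max C D) (ε := 0)
    (cA.prodMk cB)
    (fun t ht => (hA.hasDerivWithinAt (hm.mul cB) ht).prodMk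
      (hB.hasDerivWithinAt (hn.mul cA) ht)) (by simp [hA0, hB0])
    (fun t ht => by
      have ht' : t ∈ Icc a b := ⟨ht.1, ht.2.le⟩
      have h0 := (norm_nonneg _).trans (hC t ht')
      rw [add_zero, Prod.norm_mk, norm_mul, norm_mul]
      refine max_le ?_ ?_
      · exact mul_le_mul ((hC t ht').trans (le_max_left _ _)) (le_max_right _ _)
          (norm_nonneg _) (h0.trans (le_max_left _ _))
      · exact mul_le_mul ((hD t ht').trans (le_max_right _ _)) (le_max_left _ _)
          (norm_nonneg _) (h0.trans (le_max_left _ _))) x hx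
  rw [gronwallBound_ε0_δ0] at h
  have h1 := norm_le_zero_iff.1 h
  exact ⟨congrArg Prod.fst h1, congrArg Prod.snd h1⟩

section
variable {ℓ : ℝ} {f p e : ℝ → ℂ} {q : (ℝ → ℂ) → ℂ} {ρ : ℂ}

/-- `A = e / f` and `B = f D_f e` solve `A' = f⁻² B`, `B' = -ρ² f² A`. -/
theorem IsExpSolution.exists_system (hℓ : 0 < ℓ) (hf : IsExpPrimitive ℓ f p)
    (hq : IsMiura ℓ q p) (he : IsExpSolution ℓ q f ρ e) :
    ∃ B, IsPrimitive 0 ℓ (fun x => e x / f x) (fun x => (f x ^ 2)⁻¹ * B x) ∧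
      IsPrimitive 0 ℓ B (fun x => -(ρ ^ 2 * f x ^ 2) * (e x / f x)) ∧
      B 0 = Complex.I * ρ := by
  have cf := hf.continuousOn hℓ
  have hp := he.mem_domain.1.isPrimitive_of_continuousOn hℓ he.continuousOn
  have hp' := (he.mem_domain.1.exists_isPrimitive hℓ).1
  obtain ⟨B, hB, hBe⟩ := hq.exists_isPrimitive_of_schrodingerEq hℓ hf hp hp' (ae_eq_refl _) he.eq
  refine ⟨B, (hf.div hℓ hp).congr hℓ.le (fun _ _ => rfl) ?_,
    hB.congr hℓ.le (fun _ _ => rfl) ?_, ?_⟩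
  · filter_upwards [hBe, ae_restrict_mem measurableSet_Ioo] with x hx hI
    have := hf.ne_zero x (Ioo_subset_Icc_self hI)
    rw [← hx]
    field_simp
  · filter_upwards [ae_restrict_mem measurableSet_Ioo] with x hI
    have := hf.ne_zero x (Ioo_subset_Icc_self hI)
    field_simp
  · obtain ⟨v, hv, hve, hv0⟩ := he.init_deriv
    -- The initial value is prescribed for the continuous representative of `D_f e`; two continuous
    -- functions equal almost everywhere agree at the endpoint.
    have h1 : B =ᵐ[volume.restrict (Ioo 0 ℓ)] fun x => f x * v x := by
      filter_upwards [hBe, hve, hf.opD_ae_eq hℓ hp (ae_eq_refl _)] with x h1 h2 h3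
      rw [← h1, ← h2, h3]
    rw [restrict_Ioo_eq_restrict_Icc] at h1
    have h2 := Measure.eqOn_Icc_of_ae_eq volume hℓ.ne h1 (hB.continuousOn hℓ.le) (cf.mul hv)
    refine (h2 ⟨le_rfl, hℓ.le⟩).trans ?_
    simp only [hf.init, one_mul, hv0]

theorem linear_system_unique {a b : ℝ} (hab : a ≤ b) {A B A' B' m n : ℝ → ℂ}
    (hm : ContinuousOn m (Icc a b)) (hn : ContinuousOn n (Icc a b))
    (hA : IsPrimitive a b A (fun x => m x * B x)) (hB : IsPrimitive a b B (fun x => n x * A x))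
    (hA' : IsPrimitive a b A' (fun x => m x * B' x))
    (hB' : IsPrimitive a b B' (fun x => n x * A' x))
    (hA0 : A a = A' a) (hB0 : B a = B' a) : ∀ x ∈ Icc a b, A x = A' x ∧ B x = B' x := by
  intro x hx
  have := eqOn_zero_of_linear_system hab hm hn (A := fun x => A x + -1 * A' x)
    (B := fun x => B x + -1 * B' x)
    ((hA.add hab (hA'.const_mul (-1))).congr hab (fun _ _ => rfl) (.of_forall fun x => by ring))
    ((hB.add hab (hB'.const_mul (-1))).congr hab (fun _ _ => rfl) (.of_forall fun x => by ring))
    (by simp [hA0]) (by simp [hB0]) x hx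
  exact ⟨by linear_combination this.1, by linear_combination this.2⟩

/-- For `ρ = 0` the exponential solution is `f`. -/
theorem IsExpSolution.eq_of_zero (hℓ : 0 < ℓ) (hf : IsExpPrimitive ℓ f p)
    (hq : IsMiura ℓ q p) (he : IsExpSolution ℓ q f 0 e) : ∀ x ∈ Icc 0 ℓ, e x = f x := by
  intro x hx
  obtain ⟨B, h1, h2, h3⟩ := he.exists_system hℓ hf hq
  have cf := hf.continuousOn hℓ
  -- At `ρ = 0` the constant pair `(1, 0)` solves the system.
  have h4 := linear_system_unique hℓ.le
    ((cf.pow 2).inv₀ fun x hx => pow_ne_zero 2 (hf.ne_zero x hx))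
    (continuousOn_const.mul (cf.pow 2)).neg h1 h2 (A' := fun _ => 1) (B' := fun _ => 0)
    ⟨by simp, by simp⟩ ⟨by simp, by simp⟩ (by simp [he.init, hf.init]) (by simp [h3]) x hx
  exact (div_eq_one_iff_eq (hf.ne_zero x hx)).1 h4.1

/-- `D_f e_f(ρ,·) = iρ e_{1/f}(ρ,·)`. -/
theorem IsExpSolution.isPrimitive_div (hℓ : 0 < ℓ) (hf : IsExpPrimitive ℓ f p)
    (hq : IsMiura ℓ q p) {q' : (ℝ → ℂ) → ℂ} (hq' : IsMiura ℓ q' (-p)) {e' : ℝ → ℂ} (hρ : ρ ≠ 0)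
    (he : IsExpSolution ℓ q f ρ e) (he' : IsExpSolution ℓ q' f⁻¹ ρ e') :
    IsPrimitive 0 ℓ (fun x => e x / f x) (fun x => Complex.I * ρ * e' x / f x) := by
  obtain ⟨B, h1, h2, h3⟩ := he.exists_system hℓ hf hq
  obtain ⟨B', h1', h2', h3'⟩ := he'.exists_system hℓ (hf.inv hℓ) hq'
  have cf := hf.continuousOn hℓ
  have hI := Complex.I_ne_zero
  -- The system of `1/f` with its components exchanged and rescaled by `iρ` is the system of `f`;
  -- the rescaling is where `ρ ≠ 0` enters. Its second component gives `f D_f e = iρ f e'`.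
  have h4 := linear_system_unique hℓ.le
    ((cf.pow 2).inv₀ fun x hx => pow_ne_zero 2 (hf.ne_zero x hx))
    (continuousOn_const.mul (cf.pow 2)).neg h1 h2
    (A' := fun x => (Complex.I * ρ)⁻¹ * B' x) (B' := fun x => Complex.I * ρ * (e' x / f⁻¹ x))
    ((h2'.const_mul _).congr hℓ.le (fun _ _ => rfl) (by
      filter_upwards [ae_restrict_mem measurableSet_Ioo] with x hx
      have := hf.ne_zero x (Ioo_subset_Icc_self hx)
      simp only [Pi.inv_apply, Pi.pow_apply]
      field_simp
      simp only [Complex.I_sq]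
      ring))
    ((h1'.const_mul _).congr hℓ.le (fun _ _ => rfl) (.of_forall fun x => by
      simp only [Pi.inv_apply, inv_pow, inv_inv, Pi.neg_apply, Pi.mul_apply, Pi.pow_apply]
      field_simp
      simp only [Complex.I_sq]
      ring))
    (by simp only [he.init, hf.init, h3']; field_simp) (by simp [h3, he'.init, hf.init])
  refine h1.congr hℓ.le (fun _ _ => rfl) ?_
  filter_upwards [ae_restrict_mem measurableSet_Ioo] with x hx
  have := hf.ne_zero x (Ioo_subset_Icc_self hx)
  rw [(h4 x (Ioo_subset_Icc_self hx)).2, Pi.inv_apply]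
  field_simp

end

end DistSchrodinger

/-! ### The Volterra system for the kernels. -/

namespace DistSchrodinger

/-- The Volterra type operator `κ ↦ ∫_r^x p(τ) κ(τ, τ - r) dτ` on kernels. -/
noncomputable def volterraShift (p : ℝ → ℂ) (κ : ℝ → ℝ → ℂ) (x r : ℝ) : ℂ :=
  ∫ τ in Ioo r x, p τ * κ τ (τ - r)

/-- A measurable square integrable function on `ℝ` vanishing off `(0,ℓ)`. -/
structure IsSupportedL2 (ℓ : ℝ) (p : ℝ → ℂ) : Prop where
  stronglyMeasurable : StronglyMeasurable p
  memLp : MemLp p 2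
  eq_zero : ∀ x, x ∉ Ioo 0 ℓ → p x = 0

variable {ℓ : ℝ} {p : ℝ → ℂ} {κ : ℝ → ℝ → ℂ}

theorem IsSupportedL2.integrable (hp : IsSupportedL2 ℓ p) : Integrable p := by
  refine (integrableOn_iff_integrable_of_support_subset (s := Ioo 0 ℓ) ?_).1
    (MemL2.integrableOn (hp.memLp.restrict _))
  intro x hx
  by_contra h
  exact hx (hp.eq_zero x h)

theorem IsSupportedL2.integrable_sq (hp : IsSupportedL2 ℓ p) : Integrable (fun x => ‖p x‖ ^ 2) :=
  (memLp_two_iff_integrable_sq_norm hp.memLp.1).1 hp.memLp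

theorem stronglyMeasurable_volterraShift (hp : StronglyMeasurable p)
    (hκ : StronglyMeasurable (Function.uncurry κ)) :
    StronglyMeasurable (Function.uncurry (volterraShift p κ)) := by
  have hs : MeasurableSet {z : (ℝ × ℝ) × ℝ | z.1.2 < z.2 ∧ z.2 < z.1.1} :=
    (measurableSet_lt (measurable_snd.comp measurable_fst) measurable_snd).inter
      (measurableSet_lt measurable_snd (measurable_fst.comp measurable_fst))
  have hm : StronglyMeasurable (fun z : (ℝ × ℝ) × ℝ => p z.2 * κ z.2 (z.2 - z.1.2)) :=
    (hp.comp_measurable measurable_snd).mul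
      (hκ.comp_measurable (g := fun z : (ℝ × ℝ) × ℝ => (z.2, z.2 - z.1.2)) (by fun_prop))
  have := (hm.indicator hs).integral_prod_right' (ν := (volume : Measure ℝ))
  convert this using 1
  ext ⟨x, r⟩
  rw [Function.uncurry_apply_pair, volterraShift, ← integral_indicator measurableSet_Ioo]
  rfl

/-- In a suitable exponential weight, `∫ ‖p‖` over left half-lines is a contraction. -/
theorem IsSupportedL2.exists_weight (hp : IsSupportedL2 ℓ p) :
    ∃ w : ℝ, 0 < w ∧ ∀ x,
      IntegrableOn (fun τ => ‖p τ‖ * Real.exp (w * τ)) (Iio x) ∧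
      ∫ τ in Iio x, ‖p τ‖ * Real.exp (w * τ) ≤ Real.exp (w * x) / 2 := by
  set P := ∫ x, ‖p x‖ ^ 2 with hP
  have hP0 : 0 ≤ P := integral_nonneg fun x => by positivity
  -- Weighted AM-GM bounds the integral by `exp (w x) (P / (2 w) + 1 / 4)`, so any `w ≥ 2 P`
  -- suffices; the extra summand keeps `w` positive.
  refine ⟨2 * (P + 1), by positivity, fun x => ?_⟩
  set w := 2 * (P + 1) with hw
  have hw0 : 0 < w := by positivity
  have hi : IntegrableOn (fun τ => ‖p τ‖ * Real.exp (w * τ)) (Iio x) := by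
    refine Integrable.mono' (hp.integrable.norm.mul_const (Real.exp (w * x))).integrableOn
      (hp.stronglyMeasurable.norm.mul (by fun_prop)).aestronglyMeasurable ?_
    filter_upwards [ae_restrict_mem measurableSet_Iio] with τ hτ
    rw [norm_mul, norm_norm, Real.norm_eq_abs, Real.abs_exp]
    have : τ ≤ x := le_of_lt hτ
    gcongr
  refine ⟨hi, ?_⟩
  have hE : IntegrableOn (fun τ => Real.exp (2 * w * τ)) (Iio x) :=
    (integrableOn_exp_mul_Iic (by positivity) x).mono_set Iio_subset_Iic_self
  calc ∫ τ in Iio x, ‖p τ‖ * Real.exp (w * τ)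
      ≤ ∫ τ in Iio x, (Real.exp (w * x) / (2 * w) * ‖p τ‖ ^ 2
          + w * Real.exp (-(w * x)) / 2 * Real.exp (2 * w * τ)) := by
        refine setIntegral_mono hi ((hp.integrable_sq.const_mul _).integrableOn.add
          (hE.const_mul _)) fun τ => ?_
        have e1 : Real.exp (2 * w * τ) = Real.exp (w * τ) ^ 2 := by
          rw [← Real.exp_nat_mul]; congr 1; push_cast; ring
        have e2 := Real.exp_pos (w * x)
        simp only [e1, Real.exp_neg]
        have : Real.exp (w * x) / (2 * w) * ‖p τ‖ ^ 2
            + w * (Real.exp (w * x))⁻¹ / 2 * Real.exp (w * τ) ^ 2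
            - ‖p τ‖ * Real.exp (w * τ) = (Real.exp (w * x) * ‖p τ‖ - w * Real.exp (w * τ)) ^ 2
              / (2 * w * Real.exp (w * x)) := by
          field_simp
          ring
        have h2 : 0 ≤ (Real.exp (w * x) * ‖p τ‖ - w * Real.exp (w * τ)) ^ 2
              / (2 * w * Real.exp (w * x)) := by positivity
        linarith
    _ = Real.exp (w * x) / (2 * w) * (∫ τ in Iio x, ‖p τ‖ ^ 2)
          + w * Real.exp (-(w * x)) / 2 * (Real.exp (2 * w * x) / (2 * w)) := by
        rw [integral_add (hp.integrable_sq.const_mul _).integrableOn (hE.const_mul _),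
          integral_const_mul, integral_const_mul, ← integral_Iic_eq_integral_Iio (x := x) (f :=
            fun τ => Real.exp (2 * w * τ)), integral_exp_mul_Iic (by positivity)]
    _ ≤ Real.exp (w * x) / (2 * w) * P + Real.exp (w * x) / 4 := by
        have h1 : ∫ τ in Iio x, ‖p τ‖ ^ 2 ≤ P :=
          setIntegral_le_integral hp.integrable_sq (.of_forall fun x => by positivity)
        have e1 : Real.exp (2 * w * x) = Real.exp (w * x) * Real.exp (w * x) := by
          rw [← Real.exp_add]; congr 1; ring
        have e2 : w * Real.exp (-(w * x)) / 2 * (Real.exp (2 * w * x) / (2 * w))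
            = Real.exp (w * x) / 4 := by
          rw [e1, Real.exp_neg]; field_simp; norm_num
        rw [e2]
        gcongr
    _ ≤ Real.exp (w * x) / 2 := by
        have e2 := Real.exp_pos (w * x)
        have h3 : Real.exp (w * x) / (2 * w) * P ≤ Real.exp (w * x) / 4 := by
          rw [div_mul_eq_mul_div, div_le_div_iff₀ (by positivity) (by norm_num)]
          nlinarith
        linarith

theorem integrableOn_volterraShift_integrand (hp : IsSupportedL2 ℓ p) {w C x : ℝ}
    (hκ : StronglyMeasurable (Function.uncurry κ))
    (hb : ∀ τ σ, ‖κ τ σ‖ ≤ C * Real.exp (w * τ))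
    (hi : IntegrableOn (fun τ => ‖p τ‖ * Real.exp (w * τ)) (Iio x)) (r : ℝ) :
    IntegrableOn (fun τ => p τ * κ τ (τ - r)) (Ioo r x) := by
  refine Integrable.mono' ((hi.mono_set Ioo_subset_Iio_self).const_mul C)
    (hp.stronglyMeasurable.mul (hκ.comp_measurable (g := fun τ : ℝ => (τ, τ - r))
      (by fun_prop))).aestronglyMeasurable (.of_forall fun τ => ?_)
  rw [norm_mul]
  nlinarith [mul_le_mul_of_nonneg_left (hb τ (τ - r)) (norm_nonneg (p τ))]

/-- The weight makes each application of the Volterra operator halve the constant. The bound is on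
the integral of the norm, as termwise integration of the series requires. -/
theorem integral_norm_volterraShift_le (hp : IsSupportedL2 ℓ p) {w C x : ℝ}
    (hκ : StronglyMeasurable (Function.uncurry κ)) (hC : 0 ≤ C)
    (hb : ∀ τ σ, ‖κ τ σ‖ ≤ C * Real.exp (w * τ))
    (hi : IntegrableOn (fun τ => ‖p τ‖ * Real.exp (w * τ)) (Iio x))
    (hw : ∫ τ in Iio x, ‖p τ‖ * Real.exp (w * τ) ≤ Real.exp (w * x) / 2) (r : ℝ) :
    ∫ τ in Ioo r x, ‖p τ * κ τ (τ - r)‖ ≤ C / 2 * Real.exp (w * x) := by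
  calc ∫ τ in Ioo r x, ‖p τ * κ τ (τ - r)‖
      ≤ ∫ τ in Ioo r x, C * (‖p τ‖ * Real.exp (w * τ)) := by
        refine setIntegral_mono (integrableOn_volterraShift_integrand hp hκ hb hi r).norm
          ((hi.mono_set Ioo_subset_Iio_self).const_mul C) fun τ => ?_
        simp only [norm_mul]
        nlinarith [mul_le_mul_of_nonneg_left (hb τ (τ - r)) (norm_nonneg (p τ))]
    _ = C * ∫ τ in Ioo r x, ‖p τ‖ * Real.exp (w * τ) := integral_const_mul _ _
    _ ≤ C * ∫ τ in Iio x, ‖p τ‖ * Real.exp (w * τ) := by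
        gcongr
        · exact .of_forall fun x => by positivity
        · exact Ioo_subset_Iio_self
    _ ≤ C * (Real.exp (w * x) / 2) := by gcongr
    _ = C / 2 * Real.exp (w * x) := by ring

theorem hasSum_volterraShift (hp : IsSupportedL2 ℓ p) {w : ℝ} {c : ℕ → ℝ}
    {K : ℕ → ℝ → ℝ → ℂ} (hK : ∀ n, StronglyMeasurable (Function.uncurry (K n)))
    (hc : ∀ n, 0 ≤ c n) (hcs : Summable c)
    (hb : ∀ n τ σ, ‖K n τ σ‖ ≤ c n * Real.exp (w * τ))
    (hw : ∀ x, IntegrableOn (fun τ => ‖p τ‖ * Real.exp (w * τ)) (Iio x) ∧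
      ∫ τ in Iio x, ‖p τ‖ * Real.exp (w * τ) ≤ Real.exp (w * x) / 2) (x r : ℝ) :
    HasSum (fun n => volterraShift p (K n) x r)
      (volterraShift p (fun τ σ => ∑' n, K n τ σ) x r) := by
  have h := hasSum_integral_of_summable_integral_norm (μ := volume.restrict (Ioo r x))
    (F := fun n τ => p τ * K n τ (τ - r))
    (fun n => integrableOn_volterraShift_integrand hp (hK n) (hb n) (hw x).1 r)
    (Summable.of_nonneg_of_le (fun n => integral_nonneg fun τ => norm_nonneg _)
      (fun n => integral_norm_volterraShift_le hp (hK n) (hc n) (hb n) (hw x).1 (hw x).2 r)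
      ((hcs.div_const 2).mul_right _))
  simp only [tsum_mul_left] at h
  exact h

/-- This starts the iteration: the inhomogeneity `2 p` is only square integrable, and `2ab ≤ a² +
b²` with translation invariance bounds its image uniformly in `r`. -/
theorem norm_volterraShift_le (hp : IsSupportedL2 ℓ p) {k : ℝ → ℝ} {x r w : ℝ} (hw : 0 ≤ w)
    (hk : Integrable (fun σ => k σ ^ 2)) (hb : ∀ τ σ, ‖κ τ σ‖ ≤ k σ) :
    ‖volterraShift p κ x r‖
      ≤ ((∫ τ, ‖p τ‖ ^ 2) + ∫ σ, k σ ^ 2) / 2 * Real.exp (w * x) := by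
  set D := ((∫ τ, ‖p τ‖ ^ 2) + ∫ σ, k σ ^ 2) / 2 with hD
  have hD0 : 0 ≤ D := by
    have h1 : 0 ≤ ∫ τ, ‖p τ‖ ^ 2 := integral_nonneg fun x => by positivity
    have h2 : 0 ≤ ∫ σ, k σ ^ 2 := integral_nonneg fun x => by positivity
    positivity
  -- For `x ≤ 0` the weight may be small, but `p` vanishes on the range of integration; for `x > 0`
  -- the weight is at least one.
  rcases le_or_gt x 0 with hx | hx
  · have : volterraShift p κ x r = 0 := by
      refine (setIntegral_congr_fun (g := fun _ => 0) measurableSet_Ioo fun τ hτ => ?_).trans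
        (by simp)
      simp only [hp.eq_zero τ fun h => absurd h.1 (not_lt.2 (hτ.2.le.trans hx)), zero_mul]
    rw [this, norm_zero]
    positivity
  · have hi : Integrable (fun τ => (‖p τ‖ ^ 2 + k (τ - r) ^ 2) / 2) :=
      (hp.integrable_sq.add (hk.comp_sub_right r)).div_const 2
    have h1 : ‖volterraShift p κ x r‖ ≤ ∫ τ in Ioo r x, (‖p τ‖ ^ 2 + k (τ - r) ^ 2) / 2 := by
      refine norm_integral_le_of_norm_le hi.integrableOn (.of_forall fun τ => ?_)
      rw [norm_mul]
      nlinarith [mul_le_mul_of_nonneg_left (hb τ (τ - r)) (norm_nonneg (p τ)),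
        sq_nonneg (‖p τ‖ - k (τ - r))]
    have h2 : ∫ τ in Ioo r x, (‖p τ‖ ^ 2 + k (τ - r) ^ 2) / 2 ≤ D := by
      refine (setIntegral_le_integral hi (.of_forall fun τ => by positivity)).trans (le_of_eq ?_)
      rw [integral_div, integral_add hp.integrable_sq (hk.comp_sub_right r),
        integral_sub_right_eq_self (fun σ => k σ ^ 2) r]
    have h3 : (1 : ℝ) ≤ Real.exp (w * x) := Real.one_le_exp (by positivity)
    nlinarith

/-- The Volterra system `α = J (2p + γ)`, `γ = J α`. -/
theorem exists_volterra_solution (hp : IsSupportedL2 ℓ p) :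
    ∃ (α γ : ℝ → ℝ → ℂ) (C w : ℝ), StronglyMeasurable (Function.uncurry α) ∧
      StronglyMeasurable (Function.uncurry γ) ∧ 0 ≤ C ∧ 0 ≤ w ∧
      (∀ x r, ‖α x r‖ ≤ C * Real.exp (w * x)) ∧ (∀ x r, ‖γ x r‖ ≤ C * Real.exp (w * x)) ∧
      (∀ x r, α x r = volterraShift p (fun τ σ => 2 * p σ + γ τ σ) x r) ∧
      (∀ x r, γ x r = volterraShift p α x r) := by
  obtain ⟨w, hw0, hw⟩ := hp.exists_weight
  -- Neumann series: `K 0 = J (2 p)` and `K (n + 1) = J (K n)`. The even terms sum to `α`, the odd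
  -- ones to `γ`.
  let K : ℕ → ℝ → ℝ → ℂ := fun n =>
    n.rec (volterraShift p (fun _ σ => 2 * p σ)) fun _ κ => volterraShift p κ
  have hK : ∀ n, StronglyMeasurable (Function.uncurry (K n)) := by
    intro n
    induction n with
    | zero =>
      exact stronglyMeasurable_volterraShift hp.stronglyMeasurable
        ((hp.stronglyMeasurable.comp_measurable measurable_snd).const_mul 2)
    | succ n ih => exact stronglyMeasurable_volterraShift hp.stronglyMeasurable ih
  have hk2 : Integrable (fun σ => (2 * ‖p σ‖) ^ 2) := by
    simpa only [mul_pow] using hp.integrable_sq.const_mul (2 ^ 2)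
  set D := ((∫ τ, ‖p τ‖ ^ 2) + ∫ σ, (2 * ‖p σ‖) ^ 2) / 2 with hD
  have hD0 : 0 ≤ D := by
    have h1 : 0 ≤ ∫ τ, ‖p τ‖ ^ 2 := integral_nonneg fun x => by positivity
    have h2 : 0 ≤ ∫ σ, (2 * ‖p σ‖) ^ 2 := integral_nonneg fun x => by positivity
    positivity
  have hb : ∀ n τ σ, ‖K n τ σ‖ ≤ D * (1 / 2) ^ n * Real.exp (w * τ) := by
    intro n
    induction n with
    | zero =>
      intro τ σ
      rw [pow_zero, mul_one]
      exact norm_volterraShift_le hp hw0.le hk2 fun τ σ => by simp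
    | succ n ih =>
      intro τ σ
      have := (norm_integral_le_integral_norm _).trans
        (integral_norm_volterraShift_le hp (hK n) (by positivity) ih (hw τ).1 (hw τ).2 σ)
      refine (this : ‖K (n + 1) τ σ‖ ≤ _).trans (le_of_eq ?_)
      ring
  have hs : Summable fun n : ℕ => D * (1 / 2 : ℝ) ^ n := summable_geometric_two.mul_left D
  have hse : Summable fun n : ℕ => D * (1 / 2 : ℝ) ^ (2 * n) :=
    hs.comp_injective (i := fun n => 2 * n) fun a b h => by simpa using h
  have hso : Summable fun n : ℕ => D * (1 / 2 : ℝ) ^ (2 * n + 1) :=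
    hs.comp_injective (i := fun n => 2 * n + 1) fun a b h => by simpa using h
  have hsum : ∀ i : ℕ → ℕ, Summable (fun n => D * (1 / 2 : ℝ) ^ i n) → ∀ x r,
      Summable fun n => K (i n) x r := fun i hi x r =>
    Summable.of_norm_bounded (hi.mul_right (Real.exp (w * x))) fun n => hb (i n) x r
  have hbound : ∀ i : ℕ → ℕ, Function.Injective i → Summable (fun n => D * (1 / 2 : ℝ) ^ i n) →
      ∀ x r, ‖∑' n, K (i n) x r‖ ≤ (∑' n : ℕ, D * (1 / 2 : ℝ) ^ n) * Real.exp (w * x) := by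
    intro i hinj hi x r
    rw [← tsum_mul_right]
    refine (tsum_of_norm_bounded ((hi.mul_right (Real.exp (w * x))).hasSum)
      fun n => hb (i n) x r).trans ?_
    exact tsum_comp_le_tsum_of_inj (hs.mul_right _) (fun n => by positivity) hinj
  have hmeas : ∀ i : ℕ → ℕ, StronglyMeasurable (Function.uncurry fun x r => ∑' n, K (i n) x r) := by
    intro i
    refine Measurable.stronglyMeasurable ?_
    exact Measurable.tsum fun n => (hK (i n)).measurable
  refine ⟨fun x r => ∑' n, K (2 * n) x r, fun x r => ∑' n, K (2 * n + 1) x r,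
    ∑' n : ℕ, D * (1 / 2 : ℝ) ^ n, w, hmeas (fun n => 2 * n), hmeas (fun n => 2 * n + 1),
    tsum_nonneg fun n => by positivity, hw0.le,
    hbound (fun n => 2 * n) (fun a b h => by simpa using h) hse,
    hbound (fun n => 2 * n + 1) (fun a b h => by simpa using h) hso,
    fun x r => ?_, fun x r => ?_⟩
  · have h1 := hasSum_volterraShift hp (K := fun n => K (2 * n + 1)) (fun n => hK (2 * n + 1))
      (fun n => by positivity) hso (fun n => hb (2 * n + 1)) hw x r
    have i1 : IntegrableOn (fun τ => p τ * (2 * p (τ - r))) (Ioo r x) :=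
      (MemLp.integrable_mul hp.memLp ((hp.memLp.comp_measurePreserving
        (measurePreserving_sub_right volume r)).const_mul 2)).integrableOn
    have i2 := integrableOn_volterraShift_integrand hp (hmeas (fun n => 2 * n + 1))
      (hbound (fun n => 2 * n + 1) (fun a b h => by simpa using h) hso) (hw x).1 r
    have h2 : volterraShift p (fun τ σ => 2 * p σ + ∑' n, K (2 * n + 1) τ σ) x r
        = K 0 x r + volterraShift p (fun τ σ => ∑' n, K (2 * n + 1) τ σ) x r := by
      refine Eq.trans ?_ (integral_add i1 i2)
      exact integral_congr_ae (.of_forall fun τ => mul_add _ _ _)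
    beta_reduce
    rw [(hsum _ hse x r).tsum_eq_zero_add, h2, ← h1.tsum_eq]
    rfl
  · have h1 := hasSum_volterraShift hp (K := fun n => K (2 * n)) (fun n => hK (2 * n))
      (fun n => by positivity) hse (fun n => hb (2 * n)) hw x r
    rw [← h1.tsum_eq]

end DistSchrodinger

/-! ### Fourier representation of the Dirac system. -/

namespace DistSchrodinger

section
variable {ℓ : ℝ} {p : ℝ → ℂ} {κ : ℝ → ℝ → ℂ}

/-- Fubini on the triangle `0 < σ < τ < x` with the substitution `r = τ - σ`: multiplication by `p`,
modulation and integration in `τ` act on kernels as `volterraShift`. -/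
theorem volterraShift_fubini (hp : IsSupportedL2 ℓ p)
    (hκ : StronglyMeasurable (Function.uncurry κ)) {k : ℝ → ℝ} (hk : Integrable k)
    (hb : ∀ τ ∈ Ioo 0 ℓ, ∀ σ ∈ Ioo 0 ℓ, ‖κ τ σ‖ ≤ k σ) (c : ℂ) {x : ℝ} (hx : x ∈ Icc 0 ℓ) :
    IntervalIntegrable (fun τ : ℝ => p τ * (Complex.exp (c * τ) *
      ∫ σ in 0..τ, κ τ σ * Complex.exp (-(c * σ)))) volume 0 x ∧
    ∫ r in 0..x, volterraShift p κ x r * Complex.exp (c * r)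
      = ∫ τ in 0..x, p τ * (Complex.exp (c * τ) *
          ∫ σ in 0..τ, κ τ σ * Complex.exp (-(c * σ))) := by
  let S : Set (ℝ × ℝ) := {z | 0 < z.2 ∧ z.2 < z.1 ∧ z.1 < x}
  have hS : MeasurableSet S := (measurableSet_lt measurable_const measurable_snd).inter
    ((measurableSet_lt measurable_snd measurable_fst).inter
      (measurableSet_lt measurable_fst measurable_const))
  let H : ℝ × ℝ → ℂ := S.indicator fun z => p z.1 * κ z.1 z.2 * Complex.exp (c * (z.1 - z.2 : ℝ))
  have hHm : StronglyMeasurable H := by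
    refine StronglyMeasurable.indicator ?_ hS
    exact ((hp.stronglyMeasurable.comp_measurable measurable_fst).mul hκ).mul
      (Continuous.stronglyMeasurable (by fun_prop))
  have hHb : ∀ z, ‖H z‖ ≤ ‖p z.1‖ * ‖k z.2‖ * Real.exp (‖c‖ * ℓ) := by
    intro z
    by_cases hz : z ∈ S
    · simp only [H, indicator_of_mem hz, norm_mul]
      have h1 : z.1 ∈ Ioo 0 ℓ := ⟨hz.1.trans hz.2.1, hz.2.2.trans_le hx.2⟩
      have h2 := (hb z.1 h1 z.2 ⟨hz.1, hz.2.1.trans h1.2⟩).trans (Real.le_norm_self _)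
      have h3 : ‖Complex.exp (c * (z.1 - z.2 : ℝ))‖ ≤ Real.exp (‖c‖ * ℓ) := by
        refine (Complex.norm_exp_le_exp_norm _).trans (Real.exp_le_exp.2 ?_)
        rw [norm_mul, Complex.norm_real, Real.norm_eq_abs, abs_of_nonneg (by linarith [hz.2.1])]
        gcongr
        linarith [hz.1, h1.2]
      gcongr
    · simp only [H, indicator_of_notMem hz, norm_zero]
      positivity
  have hHi : Integrable H (volume.prod volume) :=
    Integrable.mono' ((hp.integrable.norm.mul_prod hk.norm).mul_const _)
      hHm.aestronglyMeasurable (.of_forall hHb)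
  -- The available measure-preserving shear is `(τ, r) ↦ (τ, r - τ)`, so the second variable is
  -- reflected first.
  have hH'i : Integrable (fun z : ℝ × ℝ => H (z.1, -z.2)) (volume.prod volume) := by
    refine Integrable.mono' ((hp.integrable.norm.mul_prod (hk.norm.comp_neg)).mul_const
      (Real.exp (‖c‖ * ℓ))) (hHm.comp_measurable (by fun_prop)).aestronglyMeasurable
      (.of_forall fun z => hHb (z.1, -z.2))
  have hGi : Integrable (Function.uncurry fun τ r => H (τ, τ - r)) (volume.prod volume) := by
    have := (measurePreserving_prod_sub (volume : Measure ℝ) (volume : Measure ℝ)).integrable_comp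
      (g := fun z : ℝ × ℝ => H (z.1, -z.2))
      hH'i.1 |>.2 hH'i
    refine this.congr (.of_forall fun z => ?_)
    simp [Function.uncurry]
  have e1 : ∀ τ, ∫ σ, H (τ, σ) = (Ioo 0 x).indicator (fun τ : ℝ => p τ * (Complex.exp (c * τ) *
          ∫ σ in 0..τ, κ τ σ * Complex.exp (-(c * σ)))) τ := by
    intro τ
    by_cases hτ : τ ∈ Ioo 0 x
    · rw [indicator_of_mem hτ, ← setIntegral_Ioo_eq hτ.1.le, ← integral_const_mul,
        ← integral_const_mul, ← integral_indicator measurableSet_Ioo]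
      refine integral_congr_ae (.of_forall fun σ => ?_)
      by_cases hσ : σ ∈ Ioo 0 τ
      · have : (τ, σ) ∈ S := ⟨hσ.1, hσ.2, hτ.2⟩
        simp only [H, indicator_of_mem this, indicator_of_mem hσ]
        push_cast
        rw [mul_sub, sub_eq_add_neg, Complex.exp_add]
        ring
      · have : (τ, σ) ∉ S := fun h => hσ ⟨h.1, h.2.1⟩
        simp only [H, indicator_of_notMem this, indicator_of_notMem hσ]
    · rw [indicator_of_notMem hτ]
      refine (integral_congr_ae (g := fun _ => 0) (.of_forall fun σ => ?_)).trans (by simp)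
      have : (τ, σ) ∉ S := fun h => hτ ⟨h.1.trans h.2.1, h.2.2⟩
      simp only [H, indicator_of_notMem this]
  have e2 : ∀ r, ∫ τ, H (τ, τ - r) = (Ioo 0 x).indicator (fun r : ℝ =>
      volterraShift p κ x r * Complex.exp (c * r)) r := by
    intro r
    by_cases hr : r ∈ Ioo 0 x
    · rw [indicator_of_mem hr, volterraShift, ← integral_mul_const,
        ← integral_indicator measurableSet_Ioo]
      refine integral_congr_ae (.of_forall fun τ => ?_)
      by_cases hτ : τ ∈ Ioo r x
      · have : (τ, τ - r) ∈ S := ⟨sub_pos.2 hτ.1, by simpa using hr.1, hτ.2⟩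
        simp only [H, indicator_of_mem this, indicator_of_mem hτ, sub_sub_cancel]
      · have : (τ, τ - r) ∉ S := fun h => hτ ⟨sub_pos.1 h.1, h.2.2⟩
        simp only [H, indicator_of_notMem this, indicator_of_notMem hτ]
    · rw [indicator_of_notMem hr]
      refine (integral_congr_ae (g := fun _ => 0) (.of_forall fun τ => ?_)).trans (by simp)
      have : (τ, τ - r) ∉ S := fun h => hr ⟨by simpa using h.2.1, (sub_pos.1 h.1).trans h.2.2⟩
      simp only [H, indicator_of_notMem this]
  constructor
  · rw [intervalIntegrable_iff_integrableOn_Ioo_of_le hx.1,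
      ← integrable_indicator_iff measurableSet_Ioo]
    exact hHi.integral_prod_left.congr (.of_forall e1)
  · rw [← setIntegral_Ioo_eq hx.1, ← setIntegral_Ioo_eq hx.1, ← integral_indicator measurableSet_Ioo,
      ← integral_indicator measurableSet_Ioo, ← integral_congr_ae (.of_forall e1),
      ← integral_congr_ae (.of_forall e2), ← integral_integral_swap hGi]
    refine integral_congr_ae (.of_forall fun τ => ?_)
    exact integral_sub_left_eq_self (fun σ => H (τ, σ)) volume τ

/-- Kernels representing the solutions of the Dirac system with potential `p`. -/
theorem exists_dirac_kernels (hℓ : 0 < ℓ) (hp : IsSupportedL2 ℓ p) :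
    ∃ (α γ : ℝ → ℝ → ℂ) (C : ℝ), StronglyMeasurable (Function.uncurry α) ∧
      StronglyMeasurable (Function.uncurry γ) ∧
      (∀ x ≤ ℓ, ∀ r, ‖α x r‖ ≤ C ∧ ‖γ x r‖ ≤ C) ∧
      ∀ ρ : ℂ, ∃ a b : ℝ → ℂ,
        (∀ x, a x = 2 + ∫ r in 0..x, α x r * Complex.exp (-(2 * Complex.I * ρ * r))) ∧
        (∀ x, b x = ∫ σ in 0..x, (2 * p σ + γ x σ) * Complex.exp (2 * Complex.I * ρ * σ)) ∧
        IsPrimitive 0 ℓ a (fun x => p x * (Complex.exp (-(2 * Complex.I * ρ * x)) * b x)) ∧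
        IsPrimitive 0 ℓ b (fun x => p x * (Complex.exp (2 * Complex.I * ρ * x) * a x)) := by
  obtain ⟨α, γ, C, w, hα, hγ, hC, hw, hαb, hγb, hαe, hγe⟩ := exists_volterra_solution hp
  have hb : ∀ x ≤ ℓ, ∀ r, ‖α x r‖ ≤ C * Real.exp (w * ℓ) ∧ ‖γ x r‖ ≤ C * Real.exp (w * ℓ) := by
    intro x hx r
    have : C * Real.exp (w * x) ≤ C * Real.exp (w * ℓ) := by gcongr
    exact ⟨(hαb x r).trans this, (hγb x r).trans this⟩
  set M := C * Real.exp (w * ℓ) with hM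
  have hMi : Integrable ((Ioo 0 ℓ).indicator fun _ => M) :=
    (integrable_indicator_iff measurableSet_Ioo).2 (by simp)
  have h0ℓ : ℓ ∈ Icc 0 ℓ := ⟨hℓ.le, le_rfl⟩
  refine ⟨α, γ, M, hα, hγ, hb, fun ρ => ⟨_, _, fun x => rfl, fun x => rfl, ?_, ?_⟩⟩
  · have hβ : StronglyMeasurable (Function.uncurry fun τ σ => 2 * p σ + γ τ σ) :=
      ((hp.stronglyMeasurable.comp_measurable measurable_snd).const_mul 2).add hγ
    have hF := fun x hx => volterraShift_fubini hp hβ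
      ((hp.integrable.norm.const_mul 2).add hMi) (fun τ hτ σ hσ => by
        simp only [Pi.add_apply, indicator_of_mem hσ]
        refine (norm_add_le _ _).trans (add_le_add (by simp) (hb τ hτ.2.le σ).2))
      (-(2 * Complex.I * ρ)) (x := x) hx
    simp only [neg_mul, neg_neg] at hF
    refine ⟨(hF ℓ h0ℓ).1, fun x hx => ?_⟩
    rw [← (hF x hx).2]
    simp only [hαe, intervalIntegral.integral_same, add_zero]
  · have hF := fun x hx => volterraShift_fubini hp hα hMi (fun τ hτ σ hσ => by
        simp only [indicator_of_mem hσ]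
        exact (hb τ hτ.2.le σ).1)
      (2 * Complex.I * ρ) (x := x) hx
    have hi : ∀ x ∈ Icc 0 ℓ, IntervalIntegrable
        (fun σ => γ x σ * Complex.exp (2 * Complex.I * ρ * σ)) volume 0 x := by
      intro x hx
      rw [intervalIntegrable_iff_integrableOn_Ioo_of_le hx.1]
      have h1 : IntegrableOn (γ x) (Ioo 0 x) := Measure.integrableOn_of_bounded (M := M) (by simp)
        (hγ.comp_measurable (g := fun σ : ℝ => (x, σ)) (by fun_prop)).aestronglyMeasurable
        (.of_forall fun σ => (hb x hx.2 σ).2)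
      exact (h1.continuousOn_mul_of_subset (K := Icc 0 x)
        (g := fun σ : ℝ => Complex.exp (2 * Complex.I * ρ * σ)) (by fun_prop) isCompact_Icc
        measurableSet_Ioo Ioo_subset_Icc_self).congr (.of_forall fun σ => mul_comm _ _)
    have hpi : ∀ x, IntervalIntegrable
        (fun σ : ℝ => p σ * (Complex.exp (2 * Complex.I * ρ * σ) * 2)) volume 0 x := fun x =>
      (hp.integrable.intervalIntegrable).mul_continuousOn (by fun_prop)
    -- The constant `2 = a(0)` produces the term `2 p σ` in the kernel of `b`; it is kept apart from
    -- `γ`, which is bounded while `p` is only square integrable.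
    have hsum : ∀ τ : ℝ, p τ * (Complex.exp (2 * Complex.I * ρ * τ) * (2 + ∫ r in 0..τ, α τ r *
          Complex.exp (-(2 * Complex.I * ρ * r))))
        = p τ * (Complex.exp (2 * Complex.I * ρ * τ) * 2) + p τ *
          (Complex.exp (2 * Complex.I * ρ * τ) * ∫ r in 0..τ, α τ r *
            Complex.exp (-(2 * Complex.I * ρ * r))) := fun τ => by ring
    refine ⟨?_, fun x hx => ?_⟩
    · simp only [hsum]
      exact (hpi ℓ).add (hF ℓ h0ℓ).1
    · simp only [hsum]
      rw [intervalIntegral.integral_add (hpi x) (hF x hx).1, ← (hF x hx).2,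
        ← intervalIntegral.integral_add (hpi x)]
      · simp only [← hγe, intervalIntegral.integral_same, zero_add]
        refine intervalIntegral.integral_congr fun σ _ => ?_
        ring
      · simp only [← hγe]
        exact hi x hx
end

end DistSchrodinger

/-! ### Existence of transmutation kernels. -/

namespace DistSchrodinger

section
variable {ℓ : ℝ} {f p : ℝ → ℂ} {q : (ℝ → ℂ) → ℂ}

theorem IsExpPrimitive.exists_isSupportedL2 (hℓ : 0 < ℓ) (hf : IsExpPrimitive ℓ f p)
    (hq : IsMiura ℓ q p) :
    ∃ p', IsSupportedL2 ℓ p' ∧ IsExpPrimitive ℓ f p' ∧ IsMiura ℓ q p' := by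
  obtain ⟨p₁, hp₁, hpe⟩ := hf.memL2.1
  let p' := (Ioo 0 ℓ).indicator p₁
  have he : p =ᵐ[volume.restrict (Ioo 0 ℓ)] p' := by
    filter_upwards [hpe, ae_restrict_mem measurableSet_Ioo] with x hx hI
    simp only [p', indicator_of_mem hI, hx]
  have hp' : MemL2 0 ℓ p' := hf.memL2.ae_eq he
  refine ⟨p', ⟨hp₁.indicator measurableSet_Ioo, ?_, fun x hx => indicator_of_notMem hx _⟩,
    ⟨hf.isPrimitive.congr hℓ.le (fun _ _ => rfl) ?_, hp', hf.ne_zero, hf.init⟩, fun φ hφ => ?_⟩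
  · exact (memLp_indicator_iff_restrict measurableSet_Ioo).2 (hf.memL2.ae_eq hpe)
  · filter_upwards [he] with x hx
    rw [hx]
  · rw [hq φ hφ]
    refine integral_congr_ae ?_
    filter_upwards [he] with x hx
    rw [hx]

/-- A pair of primitives solving `y' = p y + iρ z`, `z' = -p z + iρ y` gives the solution
`e_f(ρ, ·)`. -/
theorem IsMiura.isExpSolution (hℓ : 0 < ℓ) (hf : IsExpPrimitive ℓ f p) (hq : IsMiura ℓ q p)
    {ρ : ℂ} {y z : ℝ → ℂ}
    (hy : IsPrimitive 0 ℓ y (fun x => p x * y x + Complex.I * ρ * z x))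
    (hz : IsPrimitive 0 ℓ z (fun x => -(p x * z x) + Complex.I * ρ * y x))
    (hy0 : y 0 = 1) (hz0 : z 0 = 1) : IsExpSolution ℓ q f ρ y := by
  have cy := hy.continuousOn hℓ.le
  have cz := hz.continuousOn hℓ.le
  have hy' : MemL2 0 ℓ (fun x => p x * y x + Complex.I * ρ * z x) := by
    have h1 := hf.memL2.mul_continuousOn cy
    have h2 : MemL2 0 ℓ (fun x => Complex.I * ρ * z x) := (continuousOn_const.mul cz).memL2
    refine MemLp.ae_eq (.of_forall fun x => ?_) (MemLp.add h1 h2)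
    simp only [Pi.add_apply]
    ring
  -- The first equation reads `D_f y = iρ z`, so this is `f D_f y`.
  have hB : IsPrimitive 0 ℓ (fun x => Complex.I * ρ * (f x * z x))
      (fun x => -(f x * (ρ ^ 2 * y x))) := by
    refine ((hf.isPrimitive.mul hℓ.le hz).const_mul _).congr hℓ.le (fun _ _ => rfl)
      (.of_forall fun x => ?_)
    linear_combination f x * ρ ^ 2 * y x * Complex.I_sq
  have hS := hq.schrodingerEq_of_isPrimitive hℓ hf hy hy' (ae_eq_refl _)
    (g := fun x => ρ ^ 2 * y x) ((continuousOn_const.mul cy).memL2) hB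
    (.of_forall fun x => by ring)
  refine ⟨cy, hS.1, hS.2, hy0, fun x => Complex.I * ρ * z x, continuousOn_const.mul cz, ?_,
    by simp [hz0]⟩
  filter_upwards [hf.opD_ae_eq hℓ hy (ae_eq_refl _)] with x hx
  rw [hx]; ring

theorem measurableSet_triangle (ℓ : ℝ) : MeasurableSet (triangle ℓ) :=
  (measurableSet_le measurable_const measurable_fst).inter
    ((measurableSet_le measurable_fst measurable_const).inter
      (measurableSet_le (by fun_prop) measurable_fst))

/-- On the strip over `[0,ℓ]` the integral of the square over each vertical line is independent of
`x`, by translation invariance. -/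
theorem memLp_triangle_comp (hp : IsSupportedL2 ℓ p) :
    MemLp (fun z : ℝ × ℝ => p ((z.1 + z.2) / 2)) 2 (volume.restrict (triangle ℓ)) := by
  have hm : StronglyMeasurable (fun z : ℝ × ℝ => p ((z.1 + z.2) / 2)) :=
    hp.stronglyMeasurable.comp_measurable (by fun_prop)
  have hle : (volume : Measure (ℝ × ℝ)).restrict (triangle ℓ)
      ≤ (volume.restrict (Icc 0 ℓ)).prod volume := by
    have h := Measure.prod_restrict (μ := (volume : Measure ℝ)) (ν := (volume : Measure ℝ))
      (Icc 0 ℓ) univ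
    rw [Measure.restrict_univ] at h
    rw [h]
    have hsub : triangle ℓ ⊆ Icc 0 ℓ ×ˢ univ := fun z hz => ⟨⟨hz.1, hz.2.1⟩, mem_univ _⟩
    exact Measure.restrict_mono hsub le_rfl
  refine MemLp.mono_measure hle ?_
  rw [memLp_two_iff_integrable_sq_norm hm.aestronglyMeasurable,
    integrable_prod_iff (by exact (hm.norm.pow 2).aestronglyMeasurable)]
  have h1 : ∀ x : ℝ, Integrable fun t : ℝ => ‖p ((x + t) / 2)‖ ^ 2 := fun x =>
    ((hp.integrable_sq.comp_div two_ne_zero).comp_add_left x)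
  refine ⟨.of_forall h1, ?_⟩
  have h2 : ∀ x : ℝ, ∫ t, ‖‖p ((x + t) / 2)‖ ^ 2‖ = ∫ t, ‖‖p (t / 2)‖ ^ 2‖ := fun x =>
    integral_add_left_eq_self (fun t => ‖‖p (t / 2)‖ ^ 2‖) x
  simp only [h2]
  exact integrable_const _

theorem exists_isTransmutationKernel (hℓ : 0 < ℓ) (hf : IsExpPrimitive ℓ f p)
    (hq : IsMiura ℓ q p) : ∃ K, IsTransmutationKernel ℓ q f K := by
  obtain ⟨p, hp, hf, hq⟩ := hf.exists_isSupportedL2 hℓ hq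
  obtain ⟨α, γ, C, hα, hγ, hb, H⟩ := exists_dirac_kernels hℓ hp
  -- Since `y = (e^{iρx} a + e^{-iρx} b) / 2`, the phases become `e^{iρt}` under `t = x - 2r` in `a`
  -- and `t = 2σ - x` in `b`. The quarter is this half times the Jacobian; `2 p` becomes `K₂`.
  let K₁ : ℝ → ℝ → ℂ := fun x t => (α x ((x - t) / 2) + γ x ((x + t) / 2)) / 4
  let K₂ : ℝ → ℝ → ℂ := fun x t => p ((x + t) / 2) / 2
  have hK₁ : StronglyMeasurable (Function.uncurry K₁) :=
    (((hα.comp_measurable (g := fun z : ℝ × ℝ => (z.1, (z.1 - z.2) / 2)) (by fun_prop)).add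
      (hγ.comp_measurable (g := fun z : ℝ × ℝ => (z.1, (z.1 + z.2) / 2)) (by fun_prop))).measurable.div_const 4).stronglyMeasurable
  have hK₁b : ∀ x ≤ ℓ, ∀ t, ‖K₁ x t‖ ≤ C := by
    intro x hx t
    have h1 := (hb x hx ((x - t) / 2)).1
    have h2 := (hb x hx ((x + t) / 2)).2
    have h3 := norm_add_le (α x ((x - t) / 2)) (γ x ((x + t) / 2))
    have h4 := norm_nonneg (α x ((x - t) / 2))
    simp only [K₁, norm_div, Complex.norm_ofNat]
    linarith
  have htf : IsFiniteMeasure ((volume : Measure (ℝ × ℝ)).restrict (triangle ℓ)) := by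
    refine isFiniteMeasure_restrict.2 (ne_top_of_le_ne_top
      (isCompact_Icc (a := ((0, -ℓ) : ℝ × ℝ)) (b := (ℓ, ℓ))).measure_lt_top.ne
      (measure_mono fun z hz => ?_))
    have h3 := abs_le.1 hz.2.2
    exact ⟨⟨hz.1, by simp only; linarith [hz.2.1]⟩, ⟨hz.2.1, by simp only; linarith [hz.2.1]⟩⟩
  refine ⟨fun x t => K₁ x t + K₂ x t, ?_, fun x hx => ?_, fun ρ => ?_⟩
  · have h1 : MemLp (Function.uncurry K₁) 2 (volume.restrict (triangle ℓ)) :=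
      MemLp.of_bound hK₁.aestronglyMeasurable C
        ((ae_restrict_iff' (measurableSet_triangle ℓ)).2 (.of_forall fun z hz => hK₁b z.1 hz.2.1 z.2))
    have h2 : MemLp (Function.uncurry K₂) 2 (volume.restrict (triangle ℓ)) := by
      refine MemLp.ae_eq (.of_forall fun z => ?_) ((memLp_triangle_comp hp).const_mul (2⁻¹ : ℂ))
      exact (div_eq_inv_mul _ _).symm
    exact h1.add h2
  · have h1 : MemL2 (-x) x (K₁ x) :=
      MemLp.of_bound (hK₁.comp_measurable (g := fun t : ℝ => (x, t))
        (by fun_prop)).aestronglyMeasurable C (.of_forall fun t => hK₁b x hx.2.le t)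
    have h2 : MemL2 (-x) x (K₂ x) := by
      have hm : StronglyMeasurable (K₂ x) :=
        ((hp.stronglyMeasurable.comp_measurable (g := fun t : ℝ => (x + t) / 2)
          (by fun_prop)).measurable.div_const 2).stronglyMeasurable
      refine MemLp.restrict _ ((memLp_two_iff_integrable_sq_norm hm.aestronglyMeasurable).2 ?_)
      simp only [K₂, norm_div, div_pow]
      exact ((hp.integrable_sq.comp_div two_ne_zero).comp_add_left x).div_const _
    exact MemLp.add h1 h2
  · obtain ⟨a, b, ha, hb', hpa, hpb⟩ := H ρ
    let E : ℝ → ℂ := fun x => Complex.exp (Complex.I * ρ * x)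
    let E' : ℝ → ℂ := fun x => Complex.exp (-(Complex.I * ρ * x))
    have hE : IsPrimitive 0 ℓ E (fun x => Complex.I * ρ * E x) :=
      .of_hasDerivAt (fun x => by
        have := ((hasDerivAt_id x).ofReal_comp.const_mul (Complex.I * ρ)).cexp
        simpa [E, mul_comm] using this) (by fun_prop)
    have hE' : IsPrimitive 0 ℓ E' (fun x => -(Complex.I * ρ) * E' x) :=
      .of_hasDerivAt (fun x => by
        have := ((hasDerivAt_id x).ofReal_comp.const_mul (Complex.I * ρ)).neg.cexp
        simpa [E', mul_comm] using this) (by fun_prop)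
    have hEE : ∀ x : ℝ, E x * Complex.exp (-(2 * Complex.I * ρ * x)) = E' x := fun x => by
      simp only [E, E', ← Complex.exp_add]; congr 1; ring
    have hEE' : ∀ x : ℝ, E' x * Complex.exp (2 * Complex.I * ρ * x) = E x := fun x => by
      simp only [E, E', ← Complex.exp_add]; congr 1; ring
    have hs := hE.mul hℓ.le hpa
    have hd := hE'.mul hℓ.le hpb
    have ha0 : a 0 = 2 := by simp [ha]
    have hb0 : b 0 = 0 := by simp [hb']
    refine ⟨fun x => 2⁻¹ * (E x * a x) + 2⁻¹ * (E' x * b x),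
      hq.isExpSolution hℓ hf (z := fun x => 2⁻¹ * (E x * a x) + (-2⁻¹) * (E' x * b x)) ?_ ?_
      (by simp [E, ha0, hb0]) (by simp [E, ha0, hb0]), ?_⟩
    · refine ((hs.const_mul 2⁻¹).add hℓ.le (hd.const_mul 2⁻¹)).congr hℓ.le (fun _ _ => rfl)
        (.of_forall fun x => ?_)
      simp only
      linear_combination 2⁻¹ * p x * b x * hEE x + 2⁻¹ * p x * a x * hEE' x
    · refine ((hs.const_mul 2⁻¹).add hℓ.le (hd.const_mul (-2⁻¹))).congr hℓ.le (fun _ _ => rfl)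
        (.of_forall fun x => ?_)
      simp only
      linear_combination 2⁻¹ * p x * b x * hEE x - 2⁻¹ * p x * a x * hEE' x
    · intro x hx
      have hEc : Continuous E := by fun_prop
      have e1 : ∫ t in (-x)..x, α x ((x - t) / 2) * E t
          = 2 * (E x * ∫ r in 0..x, α x r * Complex.exp (-(2 * Complex.I * ρ * r))) := by
        have h1 := intervalIntegral.integral_comp_sub_div (a := -x) (b := x)
          (fun r => α x r * E (x - 2 * r)) two_ne_zero (x / 2)
        rw [show x / 2 - x / 2 = 0 by ring, show x / 2 - -x / 2 = x by ring] at h1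
        rw [← intervalIntegral.integral_const_mul]
        convert h1 using 1
        · refine intervalIntegral.integral_congr fun t _ => ?_
          congr 2 <;> ring
        · rw [Complex.real_smul, Complex.ofReal_ofNat]
          congr 1
          refine intervalIntegral.integral_congr fun r _ => ?_
          simp only [E]
          rw [mul_left_comm, ← Complex.exp_add]
          congr 2
          push_cast
          ring
      have e2 : ∫ t in (-x)..x, (2 * p ((x + t) / 2) + γ x ((x + t) / 2)) * E t
          = 2 * (E' x * b x) := by
        have h1 := intervalIntegral.integral_comp_add_div (a := -x) (b := x)
          (fun r => (2 * p r + γ x r) * E (2 * r - x)) two_ne_zero (x / 2)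
        rw [show x / 2 + x / 2 = x by ring, show x / 2 + -x / 2 = 0 by ring] at h1
        rw [hb', ← intervalIntegral.integral_const_mul]
        convert h1 using 1
        · refine intervalIntegral.integral_congr fun t _ => ?_
          rw [show x / 2 + t / 2 = (x + t) / 2 by ring, show 2 * ((x + t) / 2) - x = t by ring]
        · rw [Complex.real_smul, Complex.ofReal_ofNat]
          congr 1
          refine intervalIntegral.integral_congr fun r _ => ?_
          simp only [E, E']
          rw [mul_left_comm, ← Complex.exp_add]
          congr 2
          push_cast
          ring
      have hbi : ∀ φ : ℝ → ℂ, StronglyMeasurable φ → (∀ t, ‖φ t‖ ≤ C) →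
          IntervalIntegrable (fun t => φ t * E t) volume (-x) x := fun φ h1 h2 =>
        IntervalIntegrable.mul_continuousOn (intervalIntegrable_iff.2
          (Measure.integrableOn_of_bounded (M := C) (by simp) h1.aestronglyMeasurable
            (.of_forall h2))) hEc.continuousOn
      have i1 := hbi (fun t => α x ((x - t) / 2)) (hα.comp_measurable
        (g := fun t : ℝ => (x, (x - t) / 2)) (by fun_prop)) fun t => (hb x hx.2.le _).1
      have i2 := hbi (fun t => γ x ((x + t) / 2)) (hγ.comp_measurable
        (g := fun t : ℝ => (x, (x + t) / 2)) (by fun_prop)) fun t => (hb x hx.2.le _).2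
      have i3 : IntervalIntegrable (fun t => 2 * p ((x + t) / 2) * E t) volume (-x) x :=
        ((((hp.integrable.comp_div two_ne_zero).comp_add_left x).const_mul
          2).intervalIntegrable).mul_continuousOn hEc.continuousOn
      have i4 : IntervalIntegrable (fun t => (2 * p ((x + t) / 2) + γ x ((x + t) / 2)) * E t)
          volume (-x) x := by
        simpa only [add_mul] using i3.add i2
      have e3 : ∫ t in (-x)..x, (K₁ x t + K₂ x t) * E t
          = 4⁻¹ * (∫ t in (-x)..x, α x ((x - t) / 2) * E t) + 4⁻¹ *
            ∫ t in (-x)..x, (2 * p ((x + t) / 2) + γ x ((x + t) / 2)) * E t := by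
        rw [← intervalIntegral.integral_const_mul, ← intervalIntegral.integral_const_mul,
          ← intervalIntegral.integral_add (i1.const_mul _) (i4.const_mul _)]
        refine intervalIntegral.integral_congr fun t _ => ?_
        simp only [K₁, K₂]
        ring
      have e4 : transOp (fun x t => K₁ x t + K₂ x t) E x
          = E x + ∫ t in (-x)..x, (K₁ x t + K₂ x t) * E t := rfl
      refine Eq.trans ?_ e4.symm
      rw [e3, e1, e2]
      simp only [ha]
      ring
end

end DistSchrodinger

/-! ### Bounded functionals on `L²(-ℓ,ℓ)` and density of exponentials. -/

namespace DistSchrodinger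

/-- The norm of `L²(a,b)`. -/
noncomputable def normL2 (a b : ℝ) (u : ℝ → ℂ) : ℝ :=
  Real.sqrt (∫ x in Ioo a b, ‖u x‖ ^ 2)

theorem MemL2.integrableOn_sq {a b : ℝ} {u : ℝ → ℂ} (hu : MemL2 a b u) :
    IntegrableOn (fun x => ‖u x‖ ^ 2) (Ioo a b) :=
  (memLp_two_iff_integrable_sq_norm hu.1).1 hu

theorem MemL2.mono {a b c d : ℝ} {u : ℝ → ℂ} (hu : MemL2 a b u) (h : Ioo c d ⊆ Ioo a b) :
    MemL2 c d u :=
  MemLp.mono_measure (Measure.restrict_mono h le_rfl) hu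

theorem MemL2.normL2_mono {a b c d : ℝ} {u : ℝ → ℂ} (hu : MemL2 a b u) (h : Ioo c d ⊆ Ioo a b) :
    normL2 c d u ≤ normL2 a b u :=
  Real.sqrt_le_sqrt (setIntegral_mono_set hu.integrableOn_sq
    (.of_forall fun x => by positivity) h.eventuallyLE)

theorem normL2_nonneg (a b : ℝ) (u : ℝ → ℂ) : 0 ≤ normL2 a b u := Real.sqrt_nonneg _

theorem MemL2.normL2_eq {a b : ℝ} {u : ℝ → ℂ} (hu : MemL2 a b u) :
    normL2 a b u = (eLpNorm u 2 (volume.restrict (Ioo a b))).toReal := by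
  rw [MemLp.eLpNorm_eq_integral_rpow_norm (by norm_num) (by norm_num) hu,
    ENNReal.toReal_ofReal (by positivity), normL2, Real.sqrt_eq_rpow]
  norm_num

theorem MemL2.integral_norm_mul_le {a b : ℝ} {u v : ℝ → ℂ} (hu : MemL2 a b u)
    (hv : MemL2 a b v) : ∫ x in Ioo a b, ‖u x‖ * ‖v x‖ ≤ normL2 a b u * normL2 a b v := by
  have h := integral_mul_le_Lp_mul_Lq_of_nonneg (μ := volume.restrict (Ioo a b))
    Real.HolderConjugate.two_two (f := fun x => ‖u x‖) (g := fun x => ‖v x‖)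
    (.of_forall fun x => norm_nonneg _) (.of_forall fun x => norm_nonneg _)
    (by simpa using MemLp.norm hu) (by simpa using MemLp.norm hv)
  simpa only [normL2, Real.sqrt_eq_rpow, Real.rpow_two] using h

theorem MemL2.integral_norm_le {a b : ℝ} (hab : a ≤ b) {u : ℝ → ℂ} (hu : MemL2 a b u) :
    ∫ x in Ioo a b, ‖u x‖ ≤ Real.sqrt (b - a) * normL2 a b u := by
  have h := MemL2.integral_norm_mul_le (u := fun _ => 1) (a := a) (b := b)
    (continuousOn_const.memL2) hu
  simpa [normL2, hab] using h

/-- A bounded linear functional on `L²(-ℓ,ℓ)`. -/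
structure IsL2Functional (ℓ : ℝ) (Φ : (ℝ → ℂ) → ℂ) : Prop where
  map_add : ∀ u v, MemL2 (-ℓ) ℓ u → MemL2 (-ℓ) ℓ v → Φ (fun t => u t + v t) = Φ u + Φ v
  map_smul : ∀ (c : ℂ) (u), MemL2 (-ℓ) ℓ u → Φ (fun t => c * u t) = c * Φ u
  bound : ∃ C, 0 ≤ C ∧ ∀ u, MemL2 (-ℓ) ℓ u → ‖Φ u‖ ≤ C * normL2 (-ℓ) ℓ u

theorem IsL2Functional.linComb {ℓ : ℝ} {Φ Ψ : (ℝ → ℂ) → ℂ} (hΦ : IsL2Functional ℓ Φ)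
    (hΨ : IsL2Functional ℓ Ψ) (c d : ℂ) : IsL2Functional ℓ (fun u => c * Φ u + d * Ψ u) := by
  obtain ⟨C, hC, h1⟩ := hΦ.bound
  obtain ⟨D, hD, h2⟩ := hΨ.bound
  refine ⟨fun u v hu hv => ?_, fun e u hu => ?_, ‖c‖ * C + ‖d‖ * D, by positivity, fun u hu => ?_⟩
  · rw [hΦ.map_add u v hu hv, hΨ.map_add u v hu hv]; ring
  · rw [hΦ.map_smul e u hu, hΨ.map_smul e u hu]; ring
  · refine (norm_add_le _ _).trans ?_
    rw [norm_mul, norm_mul]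
    nlinarith [mul_le_mul_of_nonneg_left (h1 u hu) (norm_nonneg c),
      mul_le_mul_of_nonneg_left (h2 u hu) (norm_nonneg d)]

/-- Linear combinations of the functions `e^{(n+1)t}` are dense in `L²(-ℓ,ℓ)`. -/
theorem MemL2.exists_exp_approx {ℓ : ℝ} {h : ℝ → ℂ} (hh : MemL2 (-ℓ) ℓ h) {ε : ℝ} (hε : 0 < ε) :
    ∃ (n : ℕ) (c : ℕ → ℂ), normL2 (-ℓ) ℓ (fun t => h t - ∑ i ∈ Finset.range n,
      c i * Complex.exp (((i : ℂ) + 1) * t)) ≤ ε := by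
  obtain ⟨g, -, hg, hgc, -⟩ := MemLp.exists_hasCompactSupport_eLpNorm_sub_le (by norm_num) hh
    (ε := ENNReal.ofReal (ε / 2)) (by simpa using hε)
  obtain ⟨V, hV0, hV⟩ : ∃ V : ℝ, 0 < V ∧
      (volume.restrict (Ioo (-ℓ) ℓ)) univ ^ ((2 : ENNReal).toReal)⁻¹ ≤ ENNReal.ofReal V := by
    refine ⟨((volume.restrict (Ioo (-ℓ) ℓ)) univ ^ ((2 : ENNReal).toReal)⁻¹).toReal + 1,
      by positivity, ?_⟩
    rw [ENNReal.ofReal_add (by positivity) (by positivity), ENNReal.ofReal_toReal]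
    · exact le_self_add
    · exact (ENNReal.rpow_lt_top_of_nonneg (by positivity) (measure_ne_top _ _)).ne
  -- Real and imaginary parts cost `2 δ` and the factor `e^t` at most `exp ℓ`, giving uniform error
  -- `ε / (2 V)` and thus `L²` error `ε / 2`.
  set δ := ε / (4 * V * Real.exp ℓ) with hδ
  have hδ0 : 0 < δ := by positivity
  -- Dividing by `s = e^t` before the polynomial approximation makes every exponent at least one, so
  -- the exponent zero, where the Darboux relation degenerates, is avoided.
  let G : ℝ → ℂ := fun s => g (Real.log s) / s
  have hGc : ContinuousOn G (Icc (Real.exp (-ℓ)) (Real.exp ℓ)) := by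
    have hne : ∀ s ∈ Icc (Real.exp (-ℓ)) (Real.exp ℓ), s ≠ 0 := fun s hs =>
      ((Real.exp_pos _).trans_le hs.1).ne'
    refine ContinuousOn.div (hgc.comp_continuousOn (Real.continuousOn_log.mono fun s hs => hne s hs))
      (by fun_prop) fun s hs => by exact_mod_cast hne s hs
  obtain ⟨P, hP⟩ := exists_polynomial_near_of_continuousOn _ _ (fun s => (G s).re)
    (Complex.continuous_re.comp_continuousOn hGc) δ hδ0
  obtain ⟨Q, hQ⟩ := exists_polynomial_near_of_continuousOn _ _ (fun s => (G s).im)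
    (Complex.continuous_im.comp_continuousOn hGc) δ hδ0
  let R : Polynomial ℂ := P.map Complex.ofRealHom + Polynomial.C Complex.I * Q.map Complex.ofRealHom
  have hR : ∀ s : ℝ, R.eval (s : ℂ) = (P.eval s : ℝ) + Complex.I * (Q.eval s : ℝ) := by
    intro s
    have e (S : Polynomial ℝ) : (S.map Complex.ofRealHom).eval (s : ℂ) = (S.eval s : ℝ) := by
      simpa using Polynomial.eval_map_apply (p := S) Complex.ofRealHom s
    simp only [R, Polynomial.eval_add, Polynomial.eval_mul, Polynomial.eval_C, e]
  have hsum : ∀ t : ℝ, ∑ i ∈ Finset.range (R.natDegree + 1), R.coeff i *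
      Complex.exp (((i : ℂ) + 1) * t) = Real.exp t * R.eval ((Real.exp t : ℝ) : ℂ) := by
    intro t
    rw [Polynomial.eval_eq_sum_range, Finset.mul_sum]
    refine Finset.sum_congr rfl fun i _ => ?_
    rw [add_mul, Complex.exp_add, one_mul, Complex.exp_nat_mul, Complex.ofReal_exp]
    ring
  set S : ℝ → ℂ := fun t => ∑ i ∈ Finset.range (R.natDegree + 1), R.coeff i *
      Complex.exp (((i : ℂ) + 1) * t) with hS
  have hSc : Continuous S := by fun_prop
  have hSm : MemL2 (-ℓ) ℓ S := hSc.continuousOn.memL2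
  have hclose : ∀ t ∈ Ioo (-ℓ) ℓ, ‖g t - S t‖ ≤ ε / (2 * V) := by
    intro t ht
    have hs : Real.exp t ∈ Icc (Real.exp (-ℓ)) (Real.exp ℓ) :=
      ⟨Real.exp_le_exp.2 ht.1.le, Real.exp_le_exp.2 ht.2.le⟩
    have e1 : g t - S t = Real.exp t * (G (Real.exp t) - R.eval ((Real.exp t : ℝ) : ℂ)) := by
      have : ((Real.exp t : ℝ) : ℂ) ≠ 0 := by exact_mod_cast (Real.exp_pos t).ne'
      simp only [hS, hsum, G, Real.log_exp]
      field_simp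
    have e2 : ‖G (Real.exp t) - R.eval ((Real.exp t : ℝ) : ℂ)‖ ≤ 2 * δ := by
      refine (Complex.norm_le_abs_re_add_abs_im _).trans ?_
      have h1 := hP _ hs
      have h2 := hQ _ hs
      rw [abs_sub_comm] at h1 h2
      rw [hR]
      simp only [Complex.sub_re, Complex.sub_im, Complex.add_re, Complex.add_im, Complex.mul_re,
        Complex.mul_im, Complex.ofReal_re, Complex.ofReal_im, Complex.I_re, Complex.I_im]
      simp only [zero_mul, one_mul, mul_zero, sub_zero, add_zero, zero_add]
      linarith
    rw [e1, norm_mul, Complex.norm_real, Real.norm_eq_abs, Real.abs_exp]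
    calc Real.exp t * ‖G (Real.exp t) - R.eval ((Real.exp t : ℝ) : ℂ)‖
        ≤ Real.exp ℓ * (2 * δ) := by gcongr; exact ht.2.le
      _ = ε / (2 * V) := by rw [hδ]; field_simp; norm_num
  refine ⟨R.natDegree + 1, R.coeff, ?_⟩
  have hd : MemL2 (-ℓ) ℓ (fun t => h t - S t) := hh.sub hSm
  change normL2 (-ℓ) ℓ (fun t => h t - S t) ≤ ε
  rw [hd.normL2_eq]
  refine ENNReal.toReal_le_of_le_ofReal hε.le ?_
  have e3 : (fun t => h t - S t) = (h - g) + (g - S) := by ext t; simp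
  rw [e3]
  refine (eLpNorm_add_le (hh.1.sub hgc.aestronglyMeasurable)
    (hgc.aestronglyMeasurable.sub hSc.aestronglyMeasurable) (by norm_num)).trans ?_
  have e4 : eLpNorm (g - S) 2 (volume.restrict (Ioo (-ℓ) ℓ)) ≤ ENNReal.ofReal (ε / 2) := by
    refine (eLpNorm_le_of_ae_bound (C := ε / (2 * V))
      ((ae_restrict_iff' measurableSet_Ioo).2 (.of_forall hclose))).trans ?_
    refine (mul_le_mul_left hV _).trans ?_
    rw [← ENNReal.ofReal_mul hV0.le]
    refine ENNReal.ofReal_le_ofReal (le_of_eq ?_)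
    field_simp
  refine (add_le_add hg e4).trans ?_
  rw [← ENNReal.ofReal_add (by positivity) (by positivity), add_halves]

theorem IsL2Functional.eq_zero_of_exp {ℓ : ℝ} {Φ : (ℝ → ℂ) → ℂ} (hΦ : IsL2Functional ℓ Φ)
    (h : ∀ n : ℕ, Φ (fun t => Complex.exp (((n : ℂ) + 1) * t)) = 0) {u : ℝ → ℂ}
    (hu : MemL2 (-ℓ) ℓ u) : Φ u = 0 := by
  have hem : ∀ (n : ℕ) (c : ℕ → ℂ), MemL2 (-ℓ) ℓ (fun t : ℝ => ∑ i ∈ Finset.range n,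
      c i * Complex.exp (((i : ℂ) + 1) * t)) := fun n c =>
    Continuous.continuousOn (by fun_prop) |>.memL2
  have hexp : ∀ n : ℕ, MemL2 (-ℓ) ℓ (fun t : ℝ => Complex.exp (((n : ℂ) + 1) * t)) := fun n =>
    Continuous.continuousOn (by fun_prop) |>.memL2
  have h0 : ∀ (n : ℕ) (c : ℕ → ℂ), Φ (fun t : ℝ => ∑ i ∈ Finset.range n,
      c i * Complex.exp (((i : ℂ) + 1) * t)) = 0 := by
    intro n c
    induction n with
    | zero => simpa using hΦ.map_smul 0 _ (hexp 0)
    | succ n ih =>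
      simp only [Finset.sum_range_succ]
      rw [hΦ.map_add _ _ (hem n c) (MemLp.const_mul (hexp n) (c n)), ih,
        hΦ.map_smul _ _ (hexp n), h, mul_zero, add_zero]
  obtain ⟨C, hC, hb⟩ := hΦ.bound
  refine norm_le_zero_iff.1 (le_of_forall_pos_le_add fun ε hε => ?_)
  obtain ⟨n, c, hn⟩ := hu.exists_exp_approx (ε := ε / (C + 1)) (by positivity)
  have hd := hu.sub (hem n c)
  have h1 := hΦ.map_add _ _ hd (hem n c)
  simp only [sub_add_cancel, h0, add_zero] at h1
  have h2 : Φ u = Φ (fun x => u x - ∑ i ∈ Finset.range n,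
      c i * Complex.exp (((i : ℂ) + 1) * x)) := h1
  rw [h2]
  calc _ ≤ C * (ε / (C + 1)) := (hb _ hd).trans (by gcongr)
    _ ≤ (C + 1) * (ε / (C + 1)) := by gcongr; linarith
    _ = 0 + ε := by field_simp; ring

end DistSchrodinger

/-! ### Boundedness of the transmutation operators and of the associated functionals. -/

namespace DistSchrodinger

section
variable {ℓ : ℝ} {f p : ℝ → ℂ} {q q' : (ℝ → ℂ) → ℂ} {K K' : ℝ → ℝ → ℂ}

theorem Ioo_neg_subset {x : ℝ} (hx : x ∈ Ioo 0 ℓ) : Ioo (-x) x ⊆ Ioo (-ℓ) ℓ :=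
  Ioo_subset_Ioo (neg_le_neg hx.2.le) hx.2.le

theorem MemL2.intervalIntegrable_kernel {x : ℝ} (hx : 0 < x) {k u : ℝ → ℂ} (hk : MemL2 (-x) x k)
    (hu : MemL2 (-x) x u) : IntervalIntegrable (fun t => k t * u t) volume (-x) x :=
  (intervalIntegrable_iff_integrableOn_Ioo_of_le (by linarith)).2 (hk.integrableOn_mul hu)

theorem MemL2.norm_integral_kernel_le {x : ℝ} (hx : 0 < x) {k u : ℝ → ℂ} (hk : MemL2 (-x) x k)
    (hu : MemL2 (-x) x u) :
    ‖∫ t in (-x)..x, k t * u t‖ ≤ normL2 (-x) x k * normL2 (-x) x u := by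
  rw [← setIntegral_Ioo_eq (by linarith)]
  refine (norm_integral_le_integral_norm _).trans ?_
  simpa only [norm_mul] using hk.integral_norm_mul_le hu

theorem MemL2.intervalIntegrable {a b c d : ℝ} {u : ℝ → ℂ} (hu : MemL2 a b u) (hc : c ∈ Icc a b)
    (hd : d ∈ Icc a b) : IntervalIntegrable u volume c d := by
  have h1 : IntervalIntegrable u volume a b :=
    (intervalIntegrable_iff_integrableOn_Ioo_of_le (hc.1.trans hc.2)).2 hu.integrableOn
  exact h1.mono_set (by
    rw [uIcc_of_le (hc.1.trans hc.2)]
    exact uIcc_subset_Icc hc hd)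

theorem MemL2.norm_intervalIntegral_le {a b c d : ℝ} {u : ℝ → ℂ} (hu : MemL2 a b u)
    (hc : c ∈ Icc a b) (hd : d ∈ Icc a b) :
    ‖∫ s in c..d, u s‖ ≤ Real.sqrt (b - a) * normL2 a b u := by
  refine intervalIntegral.norm_integral_le_integral_norm_uIoc.trans ?_
  have hn : IntegrableOn (fun x => ‖u x‖) (Ioc a b) := by
    rw [integrableOn_Ioc_iff_integrableOn_Ioo]; exact hu.integrableOn.norm
  refine (setIntegral_mono_set hn (.of_forall fun x => norm_nonneg _)
    ((Ioc_subset_Ioc (le_min hc.1 hd.1) (max_le hc.2 hd.2)).eventuallyLE)).trans ?_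
  rw [integral_Ioc_eq_integral_Ioo]
  exact hu.integral_norm_le (hc.1.trans hc.2)

theorem isL2Functional_integral (hℓ : 0 < ℓ) {t : ℝ} (ht : t ∈ Icc (-ℓ) ℓ) :
    IsL2Functional ℓ (fun h => ∫ s in 0..t, h s) := by
  have h0 : (0 : ℝ) ∈ Icc (-ℓ) ℓ := ⟨by linarith, hℓ.le⟩
  refine ⟨fun u v hu hv => intervalIntegral.integral_add (hu.intervalIntegrable h0 ht)
    (hv.intervalIntegrable h0 ht), fun c u hu => intervalIntegral.integral_const_mul _ _,
    Real.sqrt (ℓ - -ℓ), Real.sqrt_nonneg _, fun u hu => ?_⟩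
  exact hu.norm_intervalIntegral_le h0 ht

theorem MemL2.continuousOn_integral (hℓ : 0 < ℓ) {h : ℝ → ℂ} (hh : MemL2 (-ℓ) ℓ h) :
    ContinuousOn (fun t => ∫ s in 0..t, h s) (Icc (-ℓ) ℓ) := by
  have h0 : (0 : ℝ) ∈ Icc (-ℓ) ℓ := ⟨by linarith, hℓ.le⟩
  have hl : -ℓ ∈ Icc (-ℓ) ℓ := ⟨le_rfl, by linarith⟩
  have hp : IsPrimitive (-ℓ) ℓ (fun t => ∫ s in 0..t, h s) h := by
    refine ⟨hh.intervalIntegrable hl ⟨by linarith, le_rfl⟩, fun x hx => ?_⟩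
    exact (intervalIntegral.integral_add_adjacent_intervals (hh.intervalIntegrable h0 hl)
      (hh.intervalIntegrable hl hx)).symm
  exact hp.continuousOn (by linarith)

theorem isL2Functional_kernel {x : ℝ} (hx : x ∈ Ioo 0 ℓ) {k : ℝ → ℂ} (hk : MemL2 (-x) x k) :
    IsL2Functional ℓ (fun h => ∫ t in (-x)..x, k t * h t) := by
  have hs := Ioo_neg_subset hx
  refine ⟨fun u v hu hv => ?_, fun c u hu => ?_, normL2 (-x) x k, normL2_nonneg _ _ _,
    fun u hu => ?_⟩
  · simp only [mul_add]
    exact intervalIntegral.integral_add (hk.intervalIntegrable_kernel hx.1 (hu.mono hs))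
      (hk.intervalIntegrable_kernel hx.1 (hv.mono hs))
  · rw [← intervalIntegral.integral_const_mul]
    simp only [mul_left_comm]
  · refine (hk.norm_integral_kernel_le hx.1 (hu.mono hs)).trans ?_
    exact mul_le_mul_of_nonneg_left (hu.normL2_mono hs) (normL2_nonneg _ _ _)

theorem normL2_le_of_norm_le {a b C : ℝ} {u : ℝ → ℂ} (hC : 0 ≤ C)
    (h : ∀ x ∈ Ioo a b, ‖u x‖ ≤ C) : normL2 a b u ≤ Real.sqrt (volume.real (Ioo a b)) * C := by
  rw [← Real.sqrt_sq hC, ← Real.sqrt_mul (by positivity), normL2]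
  refine Real.sqrt_le_sqrt ?_
  have := norm_setIntegral_le_of_norm_le_const (μ := volume) (s := Ioo a b) (C := C ^ 2)
    (f := fun x => ‖u x‖ ^ 2) (by simp) fun x hx => by
      rw [norm_pow, norm_norm]
      exact pow_le_pow_left₀ (norm_nonneg _) (h x hx) 2
  rw [mul_comm]
  exact (Real.le_norm_self _).trans this

theorem isL2Functional_kernel_integral {x : ℝ} (hx : x ∈ Ioo 0 ℓ) {k : ℝ → ℂ}
    (hk : MemL2 (-x) x k) :
    IsL2Functional ℓ (fun h => ∫ t in (-x)..x, k t * ∫ s in 0..t, h s) := by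
  have hℓ : 0 < ℓ := hx.1.trans hx.2
  have hsub : Icc (-x) x ⊆ Icc (-ℓ) ℓ := Icc_subset_Icc (neg_le_neg hx.2.le) hx.2.le
  have hm : ∀ u, MemL2 (-ℓ) ℓ u → MemL2 (-x) x (fun t => ∫ s in 0..t, u s) := fun u hu =>
    ((hu.continuousOn_integral hℓ).mono hsub).memL2
  have hIcc : ∀ t ∈ uIcc (-x) x, t ∈ Icc (-ℓ) ℓ := fun t ht => hsub (by
    rwa [uIcc_of_le (by linarith [hx.1])] at ht)
  refine ⟨fun u v hu hv => ?_, fun c u hu => ?_, normL2 (-x) x k *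
    (Real.sqrt (volume.real (Ioo (-x) x)) * Real.sqrt (ℓ - -ℓ)), ?_, fun u hu => ?_⟩
  · rw [← intervalIntegral.integral_add (hk.intervalIntegrable_kernel hx.1 (hm u hu))
      (hk.intervalIntegrable_kernel hx.1 (hm v hv))]
    refine intervalIntegral.integral_congr fun t ht => ?_
    simp only [(isL2Functional_integral hℓ (hIcc t ht)).map_add u v hu hv]
    ring
  · rw [← intervalIntegral.integral_const_mul]
    refine intervalIntegral.integral_congr fun t ht => ?_
    simp only [(isL2Functional_integral hℓ (hIcc t ht)).map_smul c u hu]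
    ring
  · have := normL2_nonneg (-x) x k
    positivity
  · refine (hk.norm_integral_kernel_le hx.1 (hm u hu)).trans ?_
    rw [mul_assoc, mul_assoc]
    refine mul_le_mul_of_nonneg_left ?_ (normL2_nonneg _ _ _)
    refine normL2_le_of_norm_le (by have := normL2_nonneg (-ℓ) ℓ u; positivity) fun t ht => ?_
    have ht' := hsub (Ioo_subset_Icc_self ht)
    exact hu.norm_intervalIntegral_le ⟨by linarith, hℓ.le⟩ ht'

/-- The `L²` norm of the sections of the kernel is a square integrable function. -/
theorem memLp_normL2_section (hK : MemLp (Function.uncurry K) 2 (volume.restrict (triangle ℓ))) :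
    MemLp (fun s => normL2 (-s) s (K s)) 2 (volume.restrict (Ioo 0 ℓ)) := by
  have h1 : Integrable ((triangle ℓ).indicator fun z => ‖Function.uncurry K z‖ ^ 2)
      (volume.prod volume) :=
    (integrable_indicator_iff (measurableSet_triangle ℓ)).2 ((memLp_two_iff_integrable_sq_norm hK.1).1 hK)
  have h2 := h1.integral_prod_left
  have e : ∀ s ∈ Ioo 0 ℓ, (∫ t, (triangle ℓ).indicator (fun z => ‖Function.uncurry K z‖ ^ 2) (s, t))
      = ∫ t in Ioo (-s) s, ‖K s t‖ ^ 2 := by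
    intro s hs
    rw [← integral_Icc_eq_integral_Ioo, ← integral_indicator measurableSet_Icc]
    refine integral_congr_ae (.of_forall fun t => ?_)
    by_cases ht : t ∈ Icc (-s) s
    · have : (s, t) ∈ triangle ℓ := ⟨hs.1.le, hs.2.le, abs_le.2 ht⟩
      simp only [indicator_of_mem this, indicator_of_mem ht, Function.uncurry_apply_pair]
    · have : (s, t) ∉ triangle ℓ := fun h => ht (abs_le.1 h.2.2)
      simp only [indicator_of_notMem this, indicator_of_notMem ht]
  have h3 : IntegrableOn (fun s => ∫ t in Ioo (-s) s, ‖K s t‖ ^ 2) (Ioo 0 ℓ) := by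
    refine h2.integrableOn.congr ?_
    filter_upwards [ae_restrict_mem measurableSet_Ioo] with s hs using e s hs
  have hm : AEStronglyMeasurable (fun s => normL2 (-s) s (K s)) (volume.restrict (Ioo 0 ℓ)) :=
    Real.continuous_sqrt.comp_aestronglyMeasurable h3.1
  refine (memLp_two_iff_integrable_sq hm).2 (h3.congr (.of_forall fun s => ?_))
  simp only [normL2]
  rw [Real.sq_sqrt (integral_nonneg fun t => by positivity)]

theorem norm_transOp_le {s : ℝ} (hs : s ∈ Ioo 0 ℓ) (hk : MemL2 (-s) s (K s)) {h : ℝ → ℂ}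
    (hh : MemL2 (-ℓ) ℓ h) :
    ‖transOp K h s‖ ≤ ‖h s‖ + normL2 (-s) s (K s) * normL2 (-ℓ) ℓ h := by
  refine (norm_add_le _ _).trans (add_le_add le_rfl ?_)
  refine (hk.norm_integral_kernel_le hs.1 (hh.mono (Ioo_neg_subset hs))).trans ?_
  exact mul_le_mul_of_nonneg_left (hh.normL2_mono (Ioo_neg_subset hs)) (normL2_nonneg _ _ _)

/-- Measurability comes from joint measurability of `K` on the triangle; the size from
Cauchy-Schwarz on sections and square integrability of the section norms. -/
theorem memL2_transOp (hK : MemLp (Function.uncurry K) 2 (volume.restrict (triangle ℓ)))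
    (hk : ∀ x ∈ Ioo 0 ℓ, MemL2 (-x) x (K x)) {h : ℝ → ℂ} (hh : MemL2 (-ℓ) ℓ h) :
    MemL2 0 ℓ (transOp K h) := by
  rcases le_or_gt ℓ 0 with hℓ | hℓ
  · simp [MemL2, Ioo_eq_empty (not_lt.2 hℓ)]
  have hm : AEStronglyMeasurable (fun s => ∫ t in (-s)..s, K s t * h t)
      (volume.restrict (Ioo 0 ℓ)) := by
    have h1 : AEStronglyMeasurable ((triangle ℓ).indicator (Function.uncurry K))
        ((volume.restrict (Ioo 0 ℓ)).prod (volume.restrict (Ioo (-ℓ) ℓ))) := by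
      rw [Measure.prod_restrict]
      exact ((aestronglyMeasurable_indicator_iff (measurableSet_triangle ℓ)).2 hK.1).mono_measure Measure.restrict_le_self
    have h2 := (h1.mul (hh.1.comp_snd (μ := volume.restrict (Ioo 0 ℓ)))).integral_prod_right'
    refine h2.congr ?_
    filter_upwards [ae_restrict_mem measurableSet_Ioo] with s hs
    rw [← setIntegral_Ioo_eq (by linarith [hs.1]), ← integral_indicator measurableSet_Ioo,
      ← integral_indicator measurableSet_Ioo]
    refine integral_congr_ae ?_
    -- The triangle contains the points `t = ±s`, the open interval does not.
    filter_upwards [compl_mem_ae_iff.mpr (measure_singleton s),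
      compl_mem_ae_iff.mpr (measure_singleton (-s))] with t ht1 ht2
    by_cases ht : t ∈ Ioo (-s) s
    · have h3 : (s, t) ∈ triangle ℓ := ⟨hs.1.le, hs.2.le, abs_le.2 ⟨ht.1.le, ht.2.le⟩⟩
      simp only [indicator_of_mem ht, indicator_of_mem (Ioo_neg_subset hs ht), Pi.mul_apply,
        indicator_of_mem h3, Function.uncurry_apply_pair]
    · have h3 : (s, t) ∉ triangle ℓ := fun h => by
        have := abs_le.1 h.2.2
        exact ht ⟨lt_of_le_of_ne this.1 (Ne.symm ht2), lt_of_le_of_ne this.2 ht1⟩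
      rw [indicator_of_notMem ht]
      by_cases ht' : t ∈ Ioo (-ℓ) ℓ
      · simp only [indicator_of_mem ht', Pi.mul_apply, indicator_of_notMem h3, zero_mul]
      · rw [indicator_of_notMem ht']
  have hh0 : MemL2 0 ℓ h := hh.mono (Ioo_subset_Ioo_left (by linarith))
  have h4 : MemL2 0 ℓ (fun s => ∫ t in (-s)..s, K s t * h t) := by
    refine MemLp.of_le_mul (c := normL2 (-ℓ) ℓ h) (memLp_normL2_section hK) hm ?_
    filter_upwards [ae_restrict_mem measurableSet_Ioo] with s hs
    rw [Real.norm_of_nonneg (normL2_nonneg _ _ _), mul_comm]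
    refine ((hk s hs).norm_integral_kernel_le hs.1 (hh.mono (Ioo_neg_subset hs))).trans ?_
    exact mul_le_mul_of_nonneg_left (hh.normL2_mono (Ioo_neg_subset hs)) (normL2_nonneg _ _ _)
  exact MemLp.add hh0 h4

/-- This makes the right side of `T_f ∫ h = f ∫ f⁻¹ T_{1/f} h` continuous in `h`; the left side is
covered by `isL2Functional_kernel_integral` and `isL2Functional_integral`. -/
theorem isL2Functional_integral_transOp
    (hK : MemLp (Function.uncurry K) 2 (volume.restrict (triangle ℓ)))
    (hk : ∀ x ∈ Ioo 0 ℓ, MemL2 (-x) x (K x)) {g : ℝ → ℂ} (hg : ContinuousOn g (Icc 0 ℓ))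
    {x : ℝ} (hx : x ∈ Ioo 0 ℓ) :
    IsL2Functional ℓ (fun h => ∫ s in 0..x, g s * transOp K h s) := by
  have hℓ : 0 < ℓ := hx.1.trans hx.2
  have h0 : (0 : ℝ) ∈ Icc 0 ℓ := ⟨le_rfl, hℓ.le⟩
  have hx' := Ioo_subset_Icc_self hx
  have hi : ∀ u, MemL2 (-ℓ) ℓ u → IntervalIntegrable (fun s => g s * transOp K u s) volume 0 x :=
    fun u hu => ((memL2_transOp hK hk hu).mul_continuousOn hg).intervalIntegrable h0 hx'
  have hsub : Ioo 0 x ⊆ Ioo 0 ℓ := Ioo_subset_Ioo_right hx.2.le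
  obtain ⟨m, hm⟩ := isCompact_Icc.exists_bound_of_continuousOn hg
  have hm0 : 0 ≤ m := (norm_nonneg _).trans (hm 0 h0)
  have hkL := (memLp_normL2_section hK).integrable (q := 2) (by norm_num)
  have hk0 : 0 ≤ ∫ s in Ioo 0 ℓ, normL2 (-s) s (K s) := integral_nonneg fun s => normL2_nonneg _ _ _
  refine ⟨fun u v hu hv => ?_, fun c u hu => ?_,
    m * (Real.sqrt (ℓ - 0) + ∫ s in Ioo 0 ℓ, normL2 (-s) s (K s)), by positivity, fun u hu => ?_⟩
  · rw [← intervalIntegral.integral_add (hi u hu) (hi v hv), ← setIntegral_Ioo_eq hx.1.le,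
      ← setIntegral_Ioo_eq hx.1.le]
    refine setIntegral_congr_fun measurableSet_Ioo fun s hs => ?_
    simp only [transOp]
    rw [(isL2Functional_kernel (hsub hs) (hk s (hsub hs))).map_add u v hu hv]
    ring
  · rw [← intervalIntegral.integral_const_mul, ← setIntegral_Ioo_eq hx.1.le,
      ← setIntegral_Ioo_eq hx.1.le]
    refine setIntegral_congr_fun measurableSet_Ioo fun s hs => ?_
    simp only [transOp]
    rw [(isL2Functional_kernel (hsub hs) (hk s (hsub hs))).map_smul c u hu]
    ring
  · have hu0 : MemL2 0 ℓ u := hu.mono (Ioo_subset_Ioo_left (by linarith))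
    have hbi : IntegrableOn (fun s => m * (‖u s‖ + normL2 (-s) s (K s) * normL2 (-ℓ) ℓ u))
        (Ioo 0 ℓ) := (hu0.integrableOn.norm.add (hkL.mul_const _)).const_mul m
    rw [← setIntegral_Ioo_eq hx.1.le]
    calc ‖∫ s in Ioo 0 x, g s * transOp K u s‖
        ≤ ∫ s in Ioo 0 x, m * (‖u s‖ + normL2 (-s) s (K s) * normL2 (-ℓ) ℓ u) := by
          refine norm_integral_le_of_norm_le (hbi.mono_set hsub) ?_
          filter_upwards [ae_restrict_mem measurableSet_Ioo] with s hs
          rw [norm_mul]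
          exact mul_le_mul (hm s (Ioo_subset_Icc_self (hsub hs)))
            (norm_transOp_le (hsub hs) (hk s (hsub hs)) hu) (norm_nonneg _) hm0
      _ ≤ ∫ s in Ioo 0 ℓ, m * (‖u s‖ + normL2 (-s) s (K s) * normL2 (-ℓ) ℓ u) := by
          refine setIntegral_mono_set hbi (.of_forall fun s => ?_) hsub.eventuallyLE
          have h1 := normL2_nonneg (-s) s (K s)
          have h2 := normL2_nonneg (-ℓ) ℓ u
          positivity
      _ = m * ((∫ s in Ioo 0 ℓ, ‖u s‖)
            + (∫ s in Ioo 0 ℓ, normL2 (-s) s (K s)) * normL2 (-ℓ) ℓ u) := by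
          rw [integral_const_mul, integral_add hu0.integrableOn.norm (hkL.mul_const _),
            integral_mul_const]
      _ ≤ m * (Real.sqrt (ℓ - 0) * normL2 (-ℓ) ℓ u
            + (∫ s in Ioo 0 ℓ, normL2 (-s) s (K s)) * normL2 (-ℓ) ℓ u) := by
          gcongr
          refine (hu0.integral_norm_le hℓ.le).trans ?_
          gcongr
          exact hu.normL2_mono (Ioo_subset_Ioo_left (by linarith))
      _ = _ := by ring

end

end DistSchrodinger

/-! ### The intertwining relation. -/

namespace DistSchrodinger

section
variable {ℓ : ℝ} {f p : ℝ → ℂ} {q q' : (ℝ → ℂ) → ℂ} {K K' : ℝ → ℝ → ℂ}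

theorem IsTransmutationKernel.transOp_one (hℓ : 0 < ℓ) (hf : IsExpPrimitive ℓ f p)
    (hq : IsMiura ℓ q p) (hK : IsTransmutationKernel ℓ q f K) {x : ℝ} (hx : x ∈ Ioo 0 ℓ) :
    1 + ∫ t in (-x)..x, K x t = f x := by
  obtain ⟨e, he, hee⟩ := hK.representation 0
  rw [← he.eq_of_zero hℓ hf hq x (Ioo_subset_Icc_self hx), hee x hx]
  simp [transOp]

/-- The integrated Darboux relation at `ρ = -ic`, for which `iρ = c`. -/
theorem IsTransmutationKernel.transOp_exp (hℓ : 0 < ℓ) (hf : IsExpPrimitive ℓ f p)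
    (hq : IsMiura ℓ q p) (hq' : IsMiura ℓ q' (-p)) (hK : IsTransmutationKernel ℓ q f K)
    (hK' : IsTransmutationKernel ℓ q' f⁻¹ K') {c : ℂ} (hc : c ≠ 0) {x : ℝ} (hx : x ∈ Ioo 0 ℓ) :
    transOp K (fun t : ℝ => Complex.exp (c * t)) x
      = f x * (1 + c * ∫ s in 0..x, (f s)⁻¹ * transOp K' (fun t : ℝ => Complex.exp (c * t)) s) := by
  obtain ⟨e, he, hee⟩ := hK.representation (-(Complex.I * c))
  obtain ⟨e', he', hee'⟩ := hK'.representation (-(Complex.I * c))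
  have hIc : Complex.I * -(Complex.I * c) = c := by
    linear_combination (-c) * Complex.I_sq
  simp only [hIc] at hee hee'
  have h1 := he.isPrimitive_div hℓ hf hq hq' (by simp [hc]) he'
  have h2 := h1.eq_add_integral x (Ioo_subset_Icc_self hx)
  rw [he.init, hf.init, hIc] at h2
  have hfx := hf.ne_zero x (Ioo_subset_Icc_self hx)
  rw [← hee x hx]
  refine (mul_div_cancel₀ (e x) hfx).symm.trans ?_
  rw [h2, ← intervalIntegral.integral_const_mul,
    ← setIntegral_Ioo_eq hx.1.le, ← setIntegral_Ioo_eq hx.1.le, div_one]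
  congr 2
  refine setIntegral_congr_fun measurableSet_Ioo fun s hs => ?_
  rw [← hee' s ⟨hs.1, hs.2.trans hx.2⟩]
  ring

/-- The difference of the two sides is a bounded functional of `h`, and it vanishes on exponentials.
There `∫₀ᵗ e^{cs} ds = (e^{ct} - 1)/c`: the exponential is handled by `transOp_exp`, the constant by
`transOp_one`. -/
theorem IsTransmutationKernel.transOp_integral (hℓ : 0 < ℓ) (hf : IsExpPrimitive ℓ f p)
    (hq : IsMiura ℓ q p) (hq' : IsMiura ℓ q' (-p)) (hK : IsTransmutationKernel ℓ q f K)
    (hK' : IsTransmutationKernel ℓ q' f⁻¹ K') {h : ℝ → ℂ} (hh : MemL2 (-ℓ) ℓ h) {x : ℝ}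
    (hx : x ∈ Ioo 0 ℓ) :
    transOp K (fun t => ∫ s in 0..t, h s) x
      = f x * ∫ s in 0..x, (f s)⁻¹ * transOp K' h s := by
  have hk := hK.memLp_section x hx
  have hx' : x ∈ Icc (-ℓ) ℓ := ⟨by linarith [hx.1], hx.2.le⟩
  have h1 := (isL2Functional_integral hℓ hx').linComb (isL2Functional_kernel_integral hx hk) 1 1
  have h2 := h1.linComb (isL2Functional_integral_transOp hK'.memLp hK'.memLp_section
    (hf.continuousOn_inv hℓ) hx) 1 (-f x)
  have h3 := h2.eq_zero_of_exp (fun n => ?_) hh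
  · simp only [transOp] at h3 ⊢
    linear_combination h3
  have hc : ((n : ℂ) + 1) ≠ 0 := Nat.cast_add_one_ne_zero n
  set c : ℂ := (n : ℂ) + 1 with hcdef
  have hint : ∀ t : ℝ, ∫ s in 0..t, Complex.exp (c * s) = (Complex.exp (c * t) - 1) / c := by
    intro t
    rw [integral_exp_mul_complex hc]
    simp
  have hki : IntervalIntegrable (K x) volume (-x) x :=
    (intervalIntegrable_iff_integrableOn_Ioo_of_le (by linarith [hx.1])).2 hk.integrableOn
  have hke : IntervalIntegrable (fun t => K x t * Complex.exp (c * t)) volume (-x) x :=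
    hki.mul_continuousOn (by fun_prop)
  have h4 : ∫ t in (-x)..x, K x t * ((Complex.exp (c * t) - 1) / c)
      = ((∫ t in (-x)..x, K x t * Complex.exp (c * t)) - ∫ t in (-x)..x, K x t) / c := by
    rw [← intervalIntegral.integral_sub hke hki, ← intervalIntegral.integral_div]
    refine intervalIntegral.integral_congr fun t _ => ?_
    ring
  have h5 := hK.transOp_exp hℓ hf hq hq' hK' hc hx
  have h6 := hK.transOp_one hℓ hf hq hx
  simp only [hint, h4]
  generalize ∫ s in 0..x, (f s)⁻¹ * transOp K' (fun t : ℝ => Complex.exp (c * t)) s = J at h5 ⊢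
  rw [transOp] at h5
  field_simp
  linear_combination h5 - h6

/-- `T_f y / f` is a primitive of `T_{1/f} y' / f`. -/
theorem IsTransmutationKernel.exists_isPrimitive (hℓ : 0 < ℓ) (hf : IsExpPrimitive ℓ f p)
    (hq : IsMiura ℓ q p) (hq' : IsMiura ℓ q' (-p)) (hK : IsTransmutationKernel ℓ q f K)
    (hK' : IsTransmutationKernel ℓ q' f⁻¹ K') {y : ℝ → ℂ} (hy : MemW12 (-ℓ) ℓ y) :
    ∃ V, IsPrimitive 0 ℓ V (fun x => (f x)⁻¹ * transOp K' (weakDeriv (-ℓ) ℓ y) x) ∧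
      transOp K y =ᵐ[volume.restrict (Ioo 0 ℓ)] fun x => f x * V x := by
  obtain ⟨hh, v, hv, hyv⟩ := hy.exists_isPrimitive (by linarith)
  set h := weakDeriv (-ℓ) ℓ y with hdef
  have hT := (memL2_transOp hK'.memLp hK'.memLp_section hh).mul_continuousOn
    (hf.continuousOn_inv hℓ)
  have h0ℓ : ℓ ∈ Icc 0 ℓ := ⟨hℓ.le, le_rfl⟩
  have h0 : (0 : ℝ) ∈ Icc (-ℓ) ℓ := ⟨by linarith, hℓ.le⟩
  -- From `y = v 0 + ∫₀ᵗ h`; the constant contributes `v 0 * f` because `T_f 1 = f`.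
  refine ⟨fun x => v 0 + ∫ s in 0..x, (f s)⁻¹ * transOp K' h s,
    ⟨hT.intervalIntegrable ⟨le_rfl, hℓ.le⟩ h0ℓ, fun x _ => by simp⟩, ?_⟩
  have hyv0 : y =ᵐ[volume.restrict (Ioo 0 ℓ)] v :=
    ae_restrict_of_ae_restrict_of_subset (Ioo_subset_Ioo_left (by linarith)) hyv
  filter_upwards [hyv0, ae_restrict_mem measurableSet_Ioo] with x hxy hx
  have hk := hK.memLp_section x hx
  have hsub : Icc (-x) x ⊆ Icc (-ℓ) ℓ := Icc_subset_Icc (neg_le_neg hx.2.le) hx.2.le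
  have hvt : ∀ t ∈ Icc (-ℓ) ℓ, v t = v 0 + ∫ s in 0..t, h s := fun t ht => by
    rw [← hv.sub_eq_integral h0 ht]; ring
  have hki : IntervalIntegrable (K x) volume (-x) x :=
    (intervalIntegrable_iff_integrableOn_Ioo_of_le (by linarith [hx.1])).2 hk.integrableOn
  have hkY : IntervalIntegrable (fun t => K x t * ∫ s in 0..t, h s) volume (-x) x :=
    hki.mul_continuousOn ((hh.continuousOn_integral hℓ).mono
      (by rwa [uIcc_of_le (by linarith [hx.1])]))
  have h1 : ∫ t in (-x)..x, K x t * y t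
      = v 0 * (∫ t in (-x)..x, K x t) + ∫ t in (-x)..x, K x t * ∫ s in 0..t, h s := by
    rw [← intervalIntegral.integral_const_mul, ← intervalIntegral.integral_add
      (hki.const_mul _) hkY, ← setIntegral_Ioo_eq (by linarith [hx.1]),
      ← setIntegral_Ioo_eq (by linarith [hx.1])]
    refine integral_congr_ae ?_
    filter_upwards [ae_restrict_of_ae_restrict_of_subset (Ioo_neg_subset hx) hyv,
      ae_restrict_mem measurableSet_Ioo] with t ht hI
    rw [ht, hvt t (hsub (Ioo_subset_Icc_self hI))]
    ring
  have h2 := hK.transOp_integral hℓ hf hq hq' hK' hh hx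
  have h3 := hK.transOp_one hℓ hf hq hx
  rw [transOp] at h2
  rw [mul_add, ← h2, ← h3, transOp, h1, hxy, hvt x ⟨by linarith [hx.1], hx.2.le⟩]
  ring

theorem IsTransmutationKernel.exists_isPrimitive_transOp (hℓ : 0 < ℓ) (hf : IsExpPrimitive ℓ f p)
    (hq : IsMiura ℓ q p) (hq' : IsMiura ℓ q' (-p)) (hK : IsTransmutationKernel ℓ q f K)
    (hK' : IsTransmutationKernel ℓ q' f⁻¹ K') {y : ℝ → ℂ} (hy : MemW12 (-ℓ) ℓ y) :
    ∃ Y Y', IsPrimitive 0 ℓ Y Y' ∧ MemL2 0 ℓ Y' ∧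
      transOp K y =ᵐ[volume.restrict (Ioo 0 ℓ)] Y ∧
      (fun x => Y' x - p x * Y x) =ᵐ[volume.restrict (Ioo 0 ℓ)]
        transOp K' (weakDeriv (-ℓ) ℓ y) := by
  obtain ⟨V, hV, hVy⟩ := hK.exists_isPrimitive hℓ hf hq hq' hK' hy
  have hh := (hy.exists_isPrimitive (by linarith)).1
  have hT := memL2_transOp hK'.memLp hK'.memLp_section hh
  have hfV := (hf.isPrimitive.mul hℓ.le hV)
  refine ⟨_, fun x => p x * (f x * V x) + transOp K' (weakDeriv (-ℓ) ℓ y) x,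
    hfV.congr hℓ.le (fun _ _ => rfl) ?_, ?_, hVy, .of_forall fun x => by ring⟩
  · filter_upwards [ae_restrict_mem measurableSet_Ioo] with x hx
    have := hf.ne_zero x (Ioo_subset_Icc_self hx)
    field_simp
  · have h1 := hf.memL2.mul_continuousOn (hfV.continuousOn hℓ.le)
    refine MemLp.ae_eq (.of_forall fun x => ?_) (MemLp.add h1 hT)
    simp only [Pi.add_apply]
    ring

end

end DistSchrodinger

theorem mainTheorem3 (ℓ : ℝ) (hℓ : 0 < ℓ) (q : (ℝ → ℂ) → ℂ)
    (hq : DistSchrodinger.IsNegSobolev 0 ℓ q) (f : ℝ → ℂ)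
    (hf : DistSchrodinger.IsNonvanishingSolution 0 ℓ q f) (hf0 : f 0 = 1) :
    (∃ K, DistSchrodinger.IsTransmutationKernel ℓ q f K) ∧
    (∃ K', DistSchrodinger.IsTransmutationKernel ℓ
      (DistSchrodinger.darbouxPotential 0 ℓ f) f⁻¹ K') ∧
    ∀ K K' : ℝ → ℝ → ℂ, DistSchrodinger.IsTransmutationKernel ℓ q f K →
      DistSchrodinger.IsTransmutationKernel ℓ
        (DistSchrodinger.darbouxPotential 0 ℓ f) f⁻¹ K' →
      (∀ y : ℝ → ℂ, DistSchrodinger.MemW12 (-ℓ) ℓ y →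
        DistSchrodinger.MemW12 0 ℓ (DistSchrodinger.transOp K y) ∧
        DistSchrodinger.opD 0 ℓ f (DistSchrodinger.transOp K y)
          =ᵐ[MeasureTheory.volume.restrict (Set.Ioo 0 ℓ)]
            DistSchrodinger.transOp K' (DistSchrodinger.weakDeriv (-ℓ) ℓ y)) ∧
      (∀ y : ℝ → ℂ, DistSchrodinger.MemW22 (-ℓ) ℓ y →
        DistSchrodinger.transOp K y ∈ DistSchrodinger.regularizationDomain 0 ℓ q ∧
        DistSchrodinger.SchrodingerEq 0 ℓ q (DistSchrodinger.transOp K y)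
          (-DistSchrodinger.transOp K
            (DistSchrodinger.weakDeriv (-ℓ) ℓ (DistSchrodinger.weakDeriv (-ℓ) ℓ y)))) := by
  have he := hf.isExpPrimitive hℓ hf0
  have hm := hf.isMiura hℓ hq hf0
  have he' := he.inv hℓ
  have hm' := he'.isMiura_potentialOf hℓ
  refine ⟨DistSchrodinger.exists_isTransmutationKernel hℓ he hm,
    DistSchrodinger.exists_isTransmutationKernel hℓ he' hm', fun K K' hK hK' =>
    ⟨fun y hy => ?_, fun y hy => ?_⟩⟩
  · obtain ⟨Y, Y', hY, hY', hyY, hD⟩ := hK.exists_isPrimitive_transOp hℓ he hm hm' hK' hy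
    exact ⟨hY.memW12 hℓ.le hY' hyY, (he.opD_ae_eq hℓ hY hyY).trans hD⟩
  · obtain ⟨Y, Y', hY, hY', hyY, hD⟩ := hK.exists_isPrimitive_transOp hℓ he hm hm' hK' hy.1
    -- The Darboux transformation is an involution, so the first-order relation applies to `y'` with
    -- the two kernels exchanged: `f T_{1/f} y'` has a representative `B` with derivative `f T_f
    -- y''`, as the regularity criterion requires.
    have hKi : DistSchrodinger.IsTransmutationKernel ℓ q f⁻¹⁻¹ K := by rwa [inv_inv]
    obtain ⟨B, hB, hBy⟩ := hK'.exists_isPrimitive hℓ he' hm' (by rwa [neg_neg]) hKi hy.2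
    have hh := (hy.2.exists_isPrimitive (by linarith)).1
    refine hm.schrodingerEq_of_isPrimitive hℓ he hY hY' hyY
      (DistSchrodinger.memL2_transOp hK.memLp hK.memLp_section hh).neg
      (hB.congr hℓ.le (fun _ _ => rfl) (.of_forall fun x => by simp)) ?_
    filter_upwards [hD, hBy, ae_restrict_mem measurableSet_Ioo] with x h1 h2 hx
    have := he.ne_zero x (Ioo_subset_Icc_self hx)
    rw [h1, h2, Pi.inv_apply]
    field_simp
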